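/- Let $d>2$. A bubble is a finite connected bipartite $d$-regular graph whose edges are colored by $\{1,\dots,d\}$, each color being incident exactly once on each vertex; $V(B)$ denotes its number of vertices, and $B(T,\bar T)$ the polynomial in a tensor $T\in(\mathbb C^N)^{\otimes d}$ and its conjugate obtained by putting a $T$ on each white vertex, a $\bar T$ on each black vertex, and contracting, for each edge of color $c$, the $c$-th indices of its two ends. For a non-empty $C\subset\{1,\dots,d\}$ with $|C|\le d/2$, a $C$-bidipole insertion replaces a vertex $u$ by vertices $w,\bar v,v$ ($w$ and $v$ having the class, black or white, of $u$, and $\bar v$ the other one) where $\bar v$ is joined to $w$ by the colors in $C$ and to $v$ by the colors not in $C$, and the former edges of $u$ are attached to $v$ for the colors in $C$ and to $w$ for the others. A generalized melonic (GM) bubble is one built from the two-vertex bubble by bidipole insertions; it is totally unbalanced if all insertions have $|C|<d/2$. Let $\{B_r\}_{r\in R}$ be a finite family of totally unbalanced GM bubbles, with $V_r=V(B_r)$ and $s_r=\sum_C|C|\,b^{(r)}_C-\frac{d(V_r-2)}2$, where $b_C^{(r)}$ is the number of $C$-bidipole insertions used to build $B_r$ from the two-vertex bubble. Consider the model with weight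 $\exp-\bigl((T|T)+\sum_{r}N^{s_r}t_rB_r(T,\bar T)\bigr)$ for the tensor $T$, where $(T|T)=\sum_{a}T_a\bar T_a$; its expectations $\langle\cdot\rangle$ are understood as formal power series in the coupling constants $(t_r)_{r\in R}$, and limits and $\mathcal O(1/N)$ are taken coefficient by coefficient. A Feynman graph on a collection of bubbles is a perfect matching of their white vertices with their black vertices by edges of color $0$ which makes the graph connected. For a bubble $B$, let $\mathbb G_{\max}(B)$ be the set of Feynman graphs on $B$ alone that maximize the total number of bicolored cycles of colors $\{0,c\}$, $c\in\{1,\dots,d\}$. For integers $b_r\ge0$, let $\mathbb G_{\max}(\{b_r,B_r\};B)$ be the set of Feynman graphs on a marked copy of $B$ and $b_r$ copies of $B_r$ for each $r$ that maximize the same number. Then: 1. The model is Gaussian at large $N$: for every bubble $B$, all $\{b_r\}$ and every $G\in\mathbb G_{\max}(\{b_r,B_r\};B)$, the marked bubble $B$ satisfies the maximal 2-cut property, i.e. there is $\pi\in\mathbb G_{\max}(B)$ such that for each pair of vertices $\{v,\pi(v)\}$ of $B$, either $v$ and $\pi(v)$ are joined in $G$ by an edge of color $0$, or the two edges of color $0$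 incident to $v$ and to $\pi(v)$ form a 2-edge-cut of $G$. 2. The large $N$ covariance $C(\{t_r\})$, given by $\langle T_a\bar T_{a'}\rangle=\delta_{aa'}C(\{t_r\})+\mathcal O(1/N)$ (uniformly in the multi-indices $a,a'$), exists and satisfies $$C(\{t_r\})=1-\sum_{r\in R}\tfrac12\,t_r\,V_r\,C(\{t_r\})^{V_r/2}.$$ 3. For every bubble $B$ there is an exponent $\Omega(B)$ such that $$\langle B(T,\bar T)\rangle=N^{\Omega(B)}\Bigl(|\mathbb G_{\max}(B)|\;C(\{t_r\})^{V(B)/2}+\mathcal O(1/N)\Bigr).$$ -/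

import Mathlib

open Filter Asymptotics MeasureTheory
open scoped ComplexConjugate Nat

/-- A finite bipartite `d`-regular graph with edges colored by `Fin d`, every color being incident
exactly once on each vertex. The edges of color `c` are the pairs `(w, edge c w)`, so they form a
perfect matching between the white and the black vertices. -/
structure ColoredGraph (d : ℕ) where
  White : Type
  Black : Type
  [fintypeWhite : Fintype White]
  [fintypeBlack : Fintype Black]
  [decEqWhite : DecidableEq White]
  [decEqBlack : DecidableEq Black]
  edge : Fin d → White ≃ Black

attribute [instance] ColoredGraph.fintypeWhite ColoredGraph.fintypeBlack
  ColoredGraph.decEqWhite ColoredGraph.decEqBlack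

namespace ColoredGraph

variable {d : ℕ}

/-- The number of vertices `V`. -/
def numVertices (B : ColoredGraph d) : ℕ := Fintype.card B.White + Fintype.card B.Black

/-- The underlying simple graph (parallel edges are identified). -/
def skeleton (B : ColoredGraph d) : SimpleGraph (B.White ⊕ B.Black) :=
  SimpleGraph.fromRel fun x y => ∃ (c : Fin d) (w : B.White), x = Sum.inl w ∧ y = Sum.inr (B.edge c w)

/-- A bubble is a connected (in particular non-empty) colored graph. -/
def IsBubble (B : ColoredGraph d) : Prop := B.skeleton.Connected

/-! ### Generalized melonic bubbles -/

/-- The bubble with two vertices. -/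
def twoVertex (d : ℕ) : ColoredGraph d where
  White := Unit
  Black := Unit
  edge := fun _ => Equiv.refl Unit

/-- Color-preserving isomorphism of colored graphs. -/
def Iso (B B' : ColoredGraph d) : Prop :=
  ∃ (f : B.White ≃ B'.White) (g : B.Black ≃ B'.Black),
    ∀ (c : Fin d) (w : B.White), B'.edge c (f w) = g (B.edge c w)

/-- Insertion of a `C`-bidipole in place of the white vertex `u`. There are two new vertices, both
called `none`. The new black vertex is joined to `some u` by the colors in `C` and to the new white
vertex by the colors not in `C`. The edges that were incident to `u` are now incident to the new
white vertex for the colors in `C` and to `some u` for the other colors. -/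
def insertAtWhite (B : ColoredGraph d) (u : B.White) (C : Finset (Fin d)) : ColoredGraph d where
  White := Option B.White
  Black := Option B.Black
  edge := fun c =>
    if c ∈ C then (Equiv.swap none (some u)).trans (Equiv.optionCongr (B.edge c))
    else Equiv.optionCongr (B.edge c)

/-- Insertion of a `C`-bidipole in place of the black vertex `u` (the same move with the two vertex
classes exchanged). -/
def insertAtBlack (B : ColoredGraph d) (u : B.Black) (C : Finset (Fin d)) : ColoredGraph d where
  White := Option B.White
  Black := Option B.Black
  edge := fun c =>
    if c ∈ C then (Equiv.optionCongr (B.edge c)).trans (Equiv.swap none (some u))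
    else Equiv.optionCongr (B.edge c)

/-- Admissible color sets: non-empty with at most half of the colors, and containing the first color
if they have exactly half of them. Since a `C`-bidipole is the same as a `Cᶜ`-bidipole, all bidipole
insertions are described by admissible sets. -/
def Admissible (C : Finset (Fin d)) : Prop :=
  C.Nonempty ∧ 2 * C.card ≤ d ∧ (2 * C.card = d → ∃ c ∈ C, (c : ℕ) = 0)

/-- `B` can be built from the two-vertex bubble by a sequence of bidipole insertions whose multiset
of (admissible) color sets is `S`. -/
inductive BuiltBy : ColoredGraph d → Multiset (Finset (Fin d)) → Prop
  | two : BuiltBy (twoVertex d) 0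
  | white {B : ColoredGraph d} {S : Multiset (Finset (Fin d))} (u : B.White) (C : Finset (Fin d))
      (hC : Admissible C) (hB : BuiltBy B S) : BuiltBy (B.insertAtWhite u C) (C ::ₘ S)
  | black {B : ColoredGraph d} {S : Multiset (Finset (Fin d))} (u : B.Black) (C : Finset (Fin d))
      (hC : Admissible C) (hB : BuiltBy B S) : BuiltBy (B.insertAtBlack u C) (C ::ₘ S)
  | iso {B B' : ColoredGraph d} {S : Multiset (Finset (Fin d))} (e : Iso B B')
      (hB : BuiltBy B S) : BuiltBy B' S

/-- `B` is a totally unbalanced generalized melonic bubble, `S` being the multiset of the color sets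
of its bidipole insertions: all of them have less than half of the colors. -/
def IsTotallyUnbalancedGM (B : ColoredGraph d) (S : Multiset (Finset (Fin d))) : Prop :=
  BuiltBy B S ∧ ∀ C ∈ S, 2 * C.card < d

/-- The scaling coefficient `∑_C |C| b_C - d (V - 2) / 2`. The division is exact, `V` being even. -/
def scaling (B : ColoredGraph d) (S : Multiset (Finset (Fin d))) : ℤ :=
  ((S.map Finset.card).sum : ℕ) - (d : ℤ) * ((B.numVertices : ℤ) - 2) / 2

/-! ### Feynman graphs -/

/-- The edges of color 0 of the Wick contraction `π`, except those whose white end is in `D`. -/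
def wickEdges (B : ColoredGraph d) (π : B.White ≃ B.Black) (D : Set B.White) :
    SimpleGraph (B.White ⊕ B.Black) :=
  SimpleGraph.fromRel fun x y => ∃ w : B.White, w ∉ D ∧ x = Sum.inl w ∧ y = Sum.inr (π w)

/-- The Feynman graphs on a (not necessarily connected) collection of bubbles: Wick contractions `π`,
i.e. perfect matchings by edges of color 0, that make the graph connected. -/
def feynmanGraphs (B : ColoredGraph d) : Set (B.White ≃ B.Black) :=
  {π | (B.skeleton ⊔ B.wickEdges π ∅).Connected}

/-- The number of bicolored cycles of colors `{0, c}`. Such a cycle alternates edges of color `c`,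
followed from white to black, and edges of color 0, followed from black to white; so its white
vertices form an orbit of the permutation `π⁻¹ ∘ edge c`. -/
noncomputable def bicoloredCycles (B : ColoredGraph d) (π : B.White ≃ B.Black) (c : Fin d) : ℕ :=
  Nat.card (Quotient (Equiv.Perm.SameCycle.setoid ((B.edge c).trans π.symm)))

/-- The total number of bicolored cycles of colors `{0, c}` for all `c`. -/
noncomputable def totalCycles (B : ColoredGraph d) (π : B.White ≃ B.Black) : ℕ :=
  ∑ c : Fin d, B.bicoloredCycles π c

/-- The Feynman graphs that maximize the total number of bicolored cycles. -/
def dominantGraphs (B : ColoredGraph d) : Set (B.White ≃ B.Black) :=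
  {π | π ∈ B.feynmanGraphs ∧ ∀ π' ∈ B.feynmanGraphs, B.totalCycles π' ≤ B.totalCycles π}

/-- Disjoint union. -/
def disjUnion (A B : ColoredGraph d) : ColoredGraph d where
  White := A.White ⊕ B.White
  Black := A.Black ⊕ B.Black
  edge := fun c => Equiv.sumCongr (A.edge c) (B.edge c)

/-- The disjoint union of `b r` copies of `B r` for all `r`. -/
def copies {R : Type} [Fintype R] [DecidableEq R] (B : R → ColoredGraph d) (b : R → ℕ) :
    ColoredGraph d where
  White := Σ r : R, Fin (b r) × (B r).White
  Black := Σ r : R, Fin (b r) × (B r).Black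
  edge := fun c => Equiv.sigmaCongrRight fun r => Equiv.prodCongr (Equiv.refl _) ((B r).edge c)

/-- In the graph with colored edges `A ⊔ Γ` and edges of color 0 given by `π`, the marked bubble `A`
satisfies the maximal 2-cut property: there is a dominant pairing `ρ` of the vertices of `A` alone
such that, for each pair `{v, ρ v}`, either `v` and `ρ v` are joined by an edge of color 0, or
deleting the two edges of color 0 incident to `v` and to `ρ v` disconnects the graph. -/
def MaximalTwoCut (A Γ : ColoredGraph d)
    (π : (A.disjUnion Γ).White ≃ (A.disjUnion Γ).Black) : Prop :=
  ∃ ρ ∈ A.dominantGraphs, ∀ v : A.White,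
    π (Sum.inl v) = Sum.inl (ρ v) ∨
      ¬ ((A.disjUnion Γ).skeleton ⊔
          (A.disjUnion Γ).wickEdges π {Sum.inl v, π.symm (Sum.inl (ρ v))}).Connected

/-- The model with interactions `B r` is Gaussian at large `N`. -/
def GaussianAtLargeN {R : Type} [Fintype R] [DecidableEq R] (B : R → ColoredGraph d) : Prop :=
  ∀ A : ColoredGraph d, A.IsBubble → ∀ (b : R → ℕ),
    ∀ π ∈ (A.disjUnion (copies B b)).dominantGraphs, MaximalTwoCut A (copies B b) π

/-! ### Tensors and expectations -/

/-- The polynomial `B(T, T̄)`: a factor `T` for each white vertex, a factor `T̄` for each black vertex,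
and an index `i c w`, summed over `{1, …, N}`, for the edge of color `c` incident to the white
vertex `w`. -/
noncomputable def poly (B : ColoredGraph d) {N : ℕ} (T : (Fin d → Fin N) → ℂ) : ℂ :=
  ∑ i : Fin d → B.White → Fin N,
    (∏ w : B.White, T fun c => i c w) *
      ∏ k : B.Black, conj (T fun c => i c ((B.edge c).symm k))

/-- The perturbative expansion, as a formal power series in the coupling constants `t_r`, of
`∫ dT dT̄ f(T, T̄) exp (-((T|T) + ∑ r, N^(s r) t_r B_r(T, T̄)))`, with Lebesgue measure on the
space of tensors of size `N`. -/
noncomputable def formalIntegral {R : Type} [Fintype R] (B : R → ColoredGraph d) (s : R → ℤ) (N : ℕ)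
    (f : ((Fin d → Fin N) → ℂ) → ℂ) : MvPowerSeries R ℂ :=
  fun m => (∏ r, (-(N : ℂ) ^ s r) ^ m r / ((m r)! : ℂ)) *
    ∫ T : (Fin d → Fin N) → ℂ,
      f T * (∏ r, (B r).poly T ^ m r) * Complex.exp (-∑ a, T a * conj (T a))

/-- The perturbative expectation `⟨f⟩`, the quotient of `formalIntegral f` by the partition function
(whose constant coefficient is the Gaussian integral). -/
noncomputable def expectation {R : Type} [Fintype R] (B : R → ColoredGraph d) (s : R → ℤ) (N : ℕ)
    (f : ((Fin d → Fin N) → ℂ) → ℂ) : MvPowerSeries R ℂ :=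
  formalIntegral B s N f * (formalIntegral B s N fun _ => 1)⁻¹

/-- `C` is the large `N` covariance: order by order in the coupling constants,
`⟨T_a T̄_a'⟩ = δ_{a a'} C + O(1/N)`, uniformly in the indices. -/
def IsLargeNCovariance {R : Type} [Fintype R] (B : R → ColoredGraph d) (s : R → ℤ)
    (C : MvPowerSeries R ℂ) : Prop :=
  ∀ m : R →₀ ℕ, ∃ K : ℝ, ∀ (N : ℕ) (a a' : Fin d → Fin N),
    ‖MvPowerSeries.coeff m (expectation B s N fun T => T a * conj (T a')) -
        (if a = a' then MvPowerSeries.coeff m C else 0)‖ ≤ K / N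

end ColoredGraph

/-! Everything rests on one extremal property of the interaction bubbles, `Tight`. A totally
unbalanced GM bubble `B` has a single pairing `ρ` with the maximal number `ω` of bicolored cycles.
Moreover, a pairing of `A ⊔ B` that joins `A` to `B` has at most `ω - d` cycles more than some
pairing `π'` of `A`, with equality only if it arises by cutting one edge of `π'` and one edge of `ρ`
and reconnecting them crosswise (`glue`).

This is proved by induction on the bidipole insertions (`Tight.contraction`). An insertion creates
two adjacent vertices sharing `d - |C| > d/2` colors. Pairing these two with each other creates a
cycle for each shared color and destroys at most one for each other color, a strict gain.
Contracting them then leads back to the smaller bubble. Counting along the construction gives `s_r =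
d - ω_r`.

Gaussianity: in a connected graph on a marked bubble `A` and tight bubbles, the bubbles are absorbed
one at a time along edges of color 0. This bounds the number of cycles by that of a pairing `σ` of
`A` plus `∑ (ω_i - d)`, and equality forces every bubble to hang on a single pair of `σ`
(`exists_labelled`). Gluing the bubbles successively onto any pairing of `A` reaches the bound
(`exists_feynmanLinked`), so dominant graphs are equality cases with `σ` dominant, and the pieces
hanging on a pair are cut off by its two edges of color 0.

Asymptotics: Wick's theorem writes Gaussian integrals of bubble polynomials as `∑ N ^ cycles` over
pairings. Sorting the pairings by the partner of a fixed white vertex of `A` gives the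
Schwinger-Dyson equation `expectation_schwingerDyson`. Its terms either have one white vertex fewer
or one coupling constant fewer, so it determines all coefficients by induction. The conjectured
leading term, the number of optimal pairings times a power of `C`, obeys the same recursion:
tightness makes the optimal pairings after absorbing `B_r` correspond to those of `A`
(`Tight.countPairings_contract`), and the fixed point equation of `C`, solvable degree by degree,
provides the rest. The deviation is therefore `O(1/N)` by induction (`deviation_isBigO`). The
covariance is the case of the two-vertex bubble, reached through the symmetries of the model. -/

namespace Equiv.Perm

/-! ### Cycle counts of permutations under transpositions and removal of a point. -/

variable {α β γ : Type*}

/-- The number of cycles of a permutation, fixed points included. -/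
noncomputable def numCycles (σ : Perm α) : ℕ := Nat.card (Quotient (SameCycle.setoid σ))

theorem SameCycle.induction_rel {σ : Perm α} {r : α → α → Prop} (hr : Equivalence r)
    (h : ∀ x, r (σ x) x) {x y : α} (hxy : SameCycle σ x y) : r x y := by
  obtain ⟨i, rfl⟩ := hxy
  induction i using Int.induction_on with
  | zero => exact hr.refl _
  | succ n ih =>
    refine hr.trans ih (hr.symm ?_)
    rw [add_comm, zpow_add, zpow_one]
    exact h _
  | pred n ih =>
    refine hr.trans ih ?_
    have : (σ ^ (-(n : ℤ))) x = σ ((σ ^ (-(n : ℤ) - 1)) x) := by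
      rw [← mul_apply, ← zpow_one_add]; congr 2; ring
    rw [this]
    exact h _

theorem SameCycle.map_eq {σ : Perm α} {f : α → β} (h : ∀ x, f (σ x) = f x) {x y : α}
    (hxy : SameCycle σ x y) : f x = f y :=
  hxy.induction_rel (r := fun x y => f x = f y)
    ⟨fun _ => Eq.refl _, fun h => h.symm, fun h h' => h.trans h'⟩ h

theorem SameCycle.map_sameCycle {σ : Perm α} {τ : Perm β} {g : α → β}
    (h : ∀ x, SameCycle τ (g (σ x)) (g x)) {x y : α} (hxy : SameCycle σ x y) :
    SameCycle τ (g x) (g y) :=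
  hxy.induction_rel (r := fun x y => SameCycle τ (g x) (g y))
    ⟨fun _ => SameCycle.refl _ _, fun h => h.symm, fun h h' => h.trans h'⟩ h

theorem numCycles_eq_card {σ : Perm α} {f : α → γ} (hs : Function.Surjective f)
    (hinv : ∀ x, f (σ x) = f x) (hsep : ∀ x y, f x = f y → SameCycle σ x y) :
    numCycles σ = Nat.card γ := by
  refine Nat.card_congr (Equiv.ofBijective
    (Quotient.lift f fun x y (h : SameCycle σ x y) => h.map_eq hinv) ⟨?_, ?_⟩)
  · intro x y
    induction x using Quotient.inductionOn
    induction y using Quotient.inductionOn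
    intro h
    exact Quotient.sound (hsep _ _ h)
  · intro c
    obtain ⟨x, rfl⟩ := hs c
    exact ⟨Quotient.mk _ x, rfl⟩

theorem sameCycle_of_mk_eq {σ : Perm α} {x y : α}
    (h : (Quotient.mk (SameCycle.setoid σ) x) = Quotient.mk _ y) : SameCycle σ x y :=
  Quotient.exact h

theorem mk_apply_eq (σ : Perm α) (x : α) :
    (Quotient.mk (SameCycle.setoid σ) (σ x)) = Quotient.mk _ x :=
  Quotient.sound (show SameCycle σ (σ x) x from sameCycle_apply_left.2 (SameCycle.refl _ _))

theorem numCycles_conj {σ : Perm α} {τ : Perm β} (e : α ≃ β) (h : ∀ x, τ (e x) = e (σ x)) :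
    numCycles τ = numCycles σ := by
  refine numCycles_eq_card (f := fun y => Quotient.mk (SameCycle.setoid σ) (e.symm y))
    ?_ ?_ ?_
  · intro q
    induction q using Quotient.inductionOn with
    | h x => exact ⟨e x, by simp⟩
  · intro y
    have := h (e.symm y)
    simp only [apply_symm_apply] at this
    simp only [this, symm_apply_apply]
    exact mk_apply_eq _ _
  · intro x y hxy
    have := (sameCycle_of_mk_eq hxy).map_sameCycle (τ := τ) (g := e) fun x => by
      rw [← h]; exact sameCycle_apply_left.2 (SameCycle.refl _ _)
    simpa using this

theorem numCycles_sumCongr [Finite α] [Finite β] (σ : Perm α) (τ : Perm β) :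
    numCycles (Equiv.sumCongr σ τ) = numCycles σ + numCycles τ := by
  rw [numCycles.eq_1 σ, numCycles.eq_1 τ]
  have : Finite (Quotient (SameCycle.setoid σ)) := Quotient.finite _
  have : Finite (Quotient (SameCycle.setoid τ)) := Quotient.finite _
  rw [← Nat.card_sum]
  refine numCycles_eq_card (f := Sum.map (Quotient.mk (SameCycle.setoid σ))
    (Quotient.mk (SameCycle.setoid τ))) (Sum.map_surjective.2 ⟨Quotient.mk_surjective,
      Quotient.mk_surjective⟩) ?_ ?_
  · rintro (x | x) <;> simp [mk_apply_eq]
  · rintro (x | x) (y | y) h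
    · simp only [Sum.map_inl, Sum.inl.injEq] at h
      exact (sameCycle_of_mk_eq h).map_sameCycle (g := Sum.inl) fun x =>
        sameCycle_apply_left (f := Equiv.sumCongr σ τ) (x := Sum.inl x).2 (SameCycle.refl _ _)
    · simp at h
    · simp at h
    · simp only [Sum.map_inr, Sum.inr.injEq] at h
      exact (sameCycle_of_mk_eq h).map_sameCycle (g := Sum.inr) fun x =>
        sameCycle_apply_left (f := Equiv.sumCongr σ τ) (x := Sum.inr x).2 (SameCycle.refl _ _)

theorem sameCycle_swap_mul [DecidableEq α] [Finite α] {σ : Perm α} {a b : α}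
    (h : ¬ SameCycle σ a b) : SameCycle (swap a b * σ) a b := by
  have hex : ∃ n, 0 < n ∧ (σ ^ n) a = a :=
    ⟨orderOf σ, orderOf_pos σ, by rw [pow_orderOf_eq_one]; rfl⟩
  classical
  -- `n` is the length of the cycle of `a`. The transposition does not act before the orbit returns
  -- to `a`, and at step `n` it sends the orbit to `b` instead.
  set n := Nat.find hex with hn
  obtain ⟨hpos, hna⟩ := Nat.find_spec hex
  have hb : ∀ j : ℕ, (σ ^ j) a ≠ b := fun j hj => h ⟨j, by simpa using hj⟩
  have key : ∀ j < n, ((swap a b * σ) ^ j) a = (σ ^ j) a := by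
    intro j
    induction j with
    | zero => simp
    | succ j ih =>
      intro hj
      rw [pow_succ', mul_apply, ih (by omega), pow_succ' σ, mul_apply, mul_apply]
      have hb' := hb (j + 1)
      rw [pow_succ', mul_apply] at hb'
      refine swap_apply_of_ne_of_ne (fun h0 => ?_) hb'
      exact Nat.find_min hex hj ⟨by omega, by rw [pow_succ', mul_apply, h0]⟩
  refine ⟨(n : ℕ), ?_⟩
  rw [zpow_natCast]
  obtain ⟨k, hk⟩ : ∃ k, n = k + 1 := ⟨n - 1, by omega⟩
  have hna' : σ ((σ ^ k) a) = a := by rw [← mul_apply, ← pow_succ', ← hk]; exact hna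
  rw [hk, pow_succ', mul_apply, key k (by omega), mul_apply, hna', swap_apply_left]

/-- The transposition merges the cycles of `a` and `b` and leaves the others alone. The classifying
map `f` therefore sends the cycle of `b` to that of `a`, so that exactly one class is lost. -/
theorem numCycles_swap_mul_add_one [DecidableEq α] [Finite α] {σ : Perm α} {a b : α}
    (h : ¬ SameCycle σ a b) : numCycles (swap a b * σ) + 1 = numCycles σ := by
  classical
  have hab := sameCycle_swap_mul h
  have hswap : ∀ z, SameCycle (swap a b * σ) (swap a b z) z := by
    intro z
    rw [swap_apply_def]
    split_ifs with h1 h2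
    · rw [h1]; exact hab.symm
    · rw [h2]; exact hab
    · exact SameCycle.refl _ _
  have hle : ∀ {x y}, SameCycle σ x y → SameCycle (swap a b * σ) x y := by
    intro x y hxy
    refine hxy.map_sameCycle (g := id) fun x => ?_
    refine (hswap (σ x)).symm.trans ?_
    exact sameCycle_apply_left (f := swap a b * σ).2 (SameCycle.refl _ _)
  have hne : (Quotient.mk (SameCycle.setoid σ) a) ≠ Quotient.mk _ b := fun h0 =>
    h (sameCycle_of_mk_eq h0)
  let f : α → {q : Quotient (SameCycle.setoid σ) // q ≠ Quotient.mk _ b} := fun x =>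
    if hx : Quotient.mk (SameCycle.setoid σ) x = Quotient.mk _ b then ⟨Quotient.mk _ a, hne⟩
    else ⟨Quotient.mk _ x, hx⟩
  have hfa : f a = ⟨Quotient.mk _ a, hne⟩ := dif_neg hne
  have hfb : f b = ⟨Quotient.mk _ a, hne⟩ := dif_pos rfl
  have hfσ : ∀ x, f (σ x) = f x := by
    intro x
    simp only [f, mk_apply_eq]
  rw [numCycles_eq_card (σ := swap a b * σ) (f := f)]
  · have : Finite (Quotient (SameCycle.setoid σ)) := Quotient.finite _
    have := Fintype.ofFinite (Quotient (SameCycle.setoid σ))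
    rw [numCycles, Nat.card_eq_fintype_card, Nat.card_eq_fintype_card,
      Fintype.card_subtype_compl, Fintype.card_subtype_eq]
    have : 0 < Fintype.card (Quotient (SameCycle.setoid σ)) :=
      Fintype.card_pos_iff.2 ⟨Quotient.mk _ a⟩
    omega
  · rintro ⟨q, hq⟩
    induction q using Quotient.inductionOn with
    | h x => exact ⟨x, dif_neg hq⟩
  · intro x
    rw [mul_apply, ← hfσ x, swap_apply_def]
    split_ifs with h1 h2
    · rw [h1, hfa, hfb]
    · rw [h2, hfa, hfb]
    · rfl
  · have hrep : ∀ x, ∃ y, (f x).1 = Quotient.mk _ y ∧ SameCycle (swap a b * σ) x y := by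
      intro x
      by_cases hx : Quotient.mk (SameCycle.setoid σ) x = Quotient.mk _ b
      · exact ⟨a, by simp [f, hx], (hle (sameCycle_of_mk_eq hx)).trans hab.symm⟩
      · exact ⟨x, by simp [f, hx], SameCycle.refl _ _⟩
    intro x y hxy
    obtain ⟨x', hx, hx'⟩ := hrep x
    obtain ⟨y', hy, hy'⟩ := hrep y
    rw [hxy, hy] at hx
    exact hx'.trans ((hle (sameCycle_of_mk_eq hx.symm)).trans hy'.symm)

theorem numCycles_le_swap_mul_add_one [DecidableEq α] [Finite α] (σ : Perm α) (a b : α) :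
    numCycles σ ≤ numCycles (swap a b * σ) + 1 := by
  by_cases h : SameCycle σ a b
  · have h2 : swap a b * (swap a b * σ) = σ := by rw [← mul_assoc, swap_mul_self, one_mul]
    by_cases h' : SameCycle (swap a b * σ) a b
    -- This case never occurs, as the transposition splits the common cycle. It is settled without
    -- excluding it: both permutations would have the same cycles.
    · have hle : ∀ {σ τ : Perm α}, τ = swap a b * σ → SameCycle τ a b → ∀ {x y},
          SameCycle σ x y → SameCycle τ x y := by
        intro σ τ hτ hab x y hxy
        refine hxy.map_sameCycle (g := id) fun x => ?_
        have hx : SameCycle τ (τ x) x := sameCycle_apply_left.2 (SameCycle.refl _ _)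
        refine SameCycle.trans ?_ hx
        rw [hτ, mul_apply, ← hτ, swap_apply_def]
        simp only [id]
        split_ifs with h1 h2
        · rw [h1]; exact hab
        · rw [h2]; exact hab.symm
        · exact SameCycle.refl _ _
      have : SameCycle.setoid σ = SameCycle.setoid (swap a b * σ) :=
        Setoid.ext fun x y => ⟨hle rfl h', hle h2.symm h⟩
      rw [numCycles, numCycles, this]
      omega
    · have := numCycles_swap_mul_add_one h'
      rw [h2] at this
      omega
  · have := numCycles_swap_mul_add_one h
    omega

/-- Removal of the point `e none`. -/
theorem numCycles_removePoint [DecidableEq β] [Finite α] {σ : Perm β} {τ : Perm α}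
    (e : Option α ≃ β)
    (h : ∀ x, σ (e (some x)) = e (some (τ x)) ∨
      (σ (e (some x)) = e none ∧ σ (e none) = e (some (τ x)))) :
    numCycles σ = numCycles τ + if σ (e none) = e none then 1 else 0 := by
  have hstep : ∀ x, SameCycle σ (σ x) x := fun x => sameCycle_apply_left.2 (SameCycle.refl _ _)
  have hmap : ∀ {x y}, SameCycle τ x y → SameCycle σ (e (some x)) (e (some y)) := by
    intro x y hxy
    refine hxy.map_sameCycle (g := fun x => e (some x)) fun x => ?_
    rcases h x with h1 | ⟨h1, h2⟩
    · simp only [← h1]; exact hstep _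
    · simp only [← h2]
      refine (hstep _).trans ?_
      rw [← h1]; exact hstep _
  split_ifs with h0
  -- A fixed point is a cycle by itself, which disappears. In the other case the point is only
  -- bypassed within a longer cycle, and its successor `z` represents it.
  · have : Finite (Quotient (SameCycle.setoid τ)) := Quotient.finite _
    rw [numCycles, numCycles, ← Finite.card_option]
    have h' : ∀ x, σ (e (some x)) = e (some (τ x)) := by
      intro x
      rcases h x with h1 | ⟨h1, h2⟩
      · exact h1
      · rw [h0] at h2
        exact absurd (e.injective h2) (by simp)
    refine numCycles_eq_card
      (f := fun y => (e.symm y).map (Quotient.mk (SameCycle.setoid τ))) ?_ ?_ ?_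
    · rintro (_ | q)
      · exact ⟨e none, by simp⟩
      · induction q using Quotient.inductionOn with
        | h x => exact ⟨e (some x), by simp⟩
    · intro y
      obtain ⟨y, rfl⟩ := e.surjective y
      cases y with
      | none => simp [h0]
      | some x => simp [h', mk_apply_eq]
    · intro x y
      obtain ⟨x, rfl⟩ := e.surjective x
      obtain ⟨y, rfl⟩ := e.surjective y
      rcases x with _ | x <;> rcases y with _ | y
      · exact fun _ => SameCycle.refl _ _
      · simp
      · simp
      · intro hxy
        exact hmap (sameCycle_of_mk_eq (by simpa using hxy))
  · obtain ⟨z, hz⟩ : ∃ z, σ (e none) = e (some z) := by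
      obtain ⟨z, hz⟩ := e.surjective (σ (e none))
      cases z with
      | none => exact absurd hz.symm h0
      | some z => exact ⟨z, hz.symm⟩
    rw [add_zero, numCycles, numCycles]
    have hrep : ∀ y : Option α, SameCycle σ (e y) (e (some (y.getD z))) := by
      rintro (_ | y)
      · simp only [Option.getD_none, ← hz]; exact (hstep _).symm
      · exact SameCycle.refl _ _
    refine numCycles_eq_card
      (f := fun y => Quotient.mk (SameCycle.setoid τ) ((e.symm y).getD z)) ?_ ?_ ?_
    · intro q
      induction q using Quotient.inductionOn with
      | h x => exact ⟨e (some x), by simp⟩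
    · intro y
      obtain ⟨y, rfl⟩ := e.surjective y
      cases y with
      | none => simp [hz]
      | some x =>
        rcases h x with h1 | ⟨h1, h2⟩
        · simp [h1, mk_apply_eq]
        · have : z = τ x := by simpa [hz] using h2
          simp [h1, this, mk_apply_eq]
    · intro x y hxy
      obtain ⟨x, rfl⟩ := e.surjective x
      obtain ⟨y, rfl⟩ := e.surjective y
      simp only [symm_apply_apply] at hxy
      exact (hrep x).trans ((hmap (sameCycle_of_mk_eq hxy)).trans (hrep y).symm)

end Equiv.Perm

/-! ### Contraction of a pair of vertices and its effect on bicolored cycles. -/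

namespace ColoredGraph

variable {d : ℕ}

open Equiv Equiv.Perm

theorem bicoloredCycles_eq (G : ColoredGraph d) (π : G.White ≃ G.Black) (c : Fin d) :
    G.bicoloredCycles π c = numCycles ((G.edge c).trans π.symm) := rfl

/-- `G'` is obtained from `G` by deleting the vertices `w` and `k` and by joining, color by color,
the edges that were incident to them. -/
structure Contraction (G G' : ColoredGraph d) (w : G.White) (k : G.Black) where
  white : Option G'.White ≃ G.White
  black : Option G'.Black ≃ G.Black
  white_none : white none = w
  black_none : black none = k
  edge : ∀ c x, G.edge c (white (some x)) = black (some (G'.edge c x)) ∨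
    (G.edge c (white (some x)) = k ∧ G.edge c w = black (some (G'.edge c x)))

/-- The number of edges between `w` and `k`. -/
def loops (G : ColoredGraph d) (w : G.White) (k : G.Black) : ℕ :=
  (Finset.univ.filter fun c => G.edge c w = k).card

theorem loops_eq_card {G : ColoredGraph d} {w : G.White} {k : G.Black} {s : Finset (Fin d)}
    (h : ∀ c, G.edge c w = k ↔ c ∈ s) : G.loops w k = s.card := by
  unfold loops
  congr 1
  ext c
  simp [h]

namespace Contraction

variable {G G' : ColoredGraph d} {w : G.White} {k : G.Black}

/-- The pairing of `G` that pairs `w` with `k` and the other vertices as in `G'`. -/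
def extend (κ : Contraction G G' w k) (π : G'.White ≃ G'.Black) : G.White ≃ G.Black :=
  κ.white.symm.trans ((Equiv.optionCongr π).trans κ.black)

@[simp] theorem extend_apply (κ : Contraction G G' w k) (π : G'.White ≃ G'.Black) :
    κ.extend π w = k := by
  have h : κ.white.symm w = none := by rw [Equiv.symm_apply_eq, κ.white_none]
  simp [extend, h, κ.black_none]

@[simp] theorem extend_white_some (κ : Contraction G G' w k) (π : G'.White ≃ G'.Black)
    (x : G'.White) : κ.extend π (κ.white (some x)) = κ.black (some (π x)) := by
  simp [extend]

theorem extend_injective (κ : Contraction G G' w k) : Function.Injective κ.extend := by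
  intro π π' h
  ext x
  have := congrArg (fun e => e (κ.white (some x))) h
  simpa using this

theorem exists_extend_eq (κ : Contraction G G' w k) {π : G.White ≃ G.Black} (h : π w = k) :
    ∃ π', κ.extend π' = π := by
  let ρ : Option G'.White ≃ Option G'.Black := κ.white.trans (π.trans κ.black.symm)
  have hρ : ρ none = none := by
    simp [ρ, κ.white_none, h, ← κ.black_none]
  refine ⟨Equiv.removeNone ρ, ?_⟩
  have hsome : ∀ x, some (Equiv.removeNone ρ x) = ρ (some x) := fun x => by
    apply Equiv.removeNone_some
    cases hx : ρ (some x) with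
    | none => exact absurd (ρ.injective (hx.trans hρ.symm)) (by simp)
    | some y => exact ⟨y, rfl⟩
  ext x
  obtain ⟨x, rfl⟩ := κ.white.surjective x
  cases x with
  | none => rw [κ.white_none, extend_apply, h]
  | some x => rw [extend_white_some, hsome]; simp [ρ]

/-- For each color, contracting removes the point `w` from the permutation whose cycles are counted.
A cycle is lost exactly when `w` is fixed, that is, when an edge of this color joins `w` to its
partner `k`. -/
theorem totalCycles_extend (κ : Contraction G G' w k) (π : G'.White ≃ G'.Black) :
    G.totalCycles (κ.extend π) = G'.totalCycles π + G.loops w k := by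
  unfold totalCycles loops
  rw [Finset.card_filter, ← Finset.sum_add_distrib]
  refine Finset.sum_congr rfl fun c _ => ?_
  rw [bicoloredCycles_eq, bicoloredCycles_eq,
    numCycles_removePoint (τ := (G'.edge c).trans π.symm) κ.white]
  · congr 2
    rw [κ.white_none]
    simp [Equiv.symm_apply_eq]
  · intro x
    have hs : ∀ y, (κ.extend π).symm (κ.black (some y)) = κ.white (some (π.symm y)) := fun y => by
      simp [Equiv.symm_apply_eq]
    simp only [Equiv.trans_apply, κ.white_none, ← hs]
    simp only [Equiv.apply_eq_iff_eq, Equiv.symm_apply_eq, extend_apply]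
    exact κ.edge c x

end Contraction

/-- For a color joining `w` to `k`, `w` is a cycle by itself, and unpairing `w` and `k` merges it
into another cycle. Each of the remaining `d - loops` colors gains at most one cycle. -/
theorem totalCycles_swap_le {G : ColoredGraph d} {w : G.White} {k : G.Black}
    {π : G.White ≃ G.Black} (h : π w = k) {x : G.White} (hx : x ≠ w) :
    G.totalCycles ((swap w x).trans π) + 2 * G.loops w k ≤ G.totalCycles π + d := by
  unfold totalCycles loops
  have hd : ∑ c, G.bicoloredCycles π c + d = ∑ c, (G.bicoloredCycles π c + 1) := by
    simp [Finset.sum_add_distrib]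
  rw [hd, Finset.card_filter, Finset.mul_sum, ← Finset.sum_add_distrib]
  refine Finset.sum_le_sum fun c _ => ?_
  rw [bicoloredCycles_eq, bicoloredCycles_eq]
  have hσ : (G.edge c).trans ((swap w x).trans π).symm =
      swap w x * (G.edge c).trans π.symm := rfl
  rw [hσ]
  split_ifs with hc
  · have hfix : ((G.edge c).trans π.symm) w = w := by simp [Equiv.symm_apply_eq, hc, h]
    have := numCycles_swap_mul_add_one (σ := (G.edge c).trans π.symm) (a := w) (b := x)
      fun hs => hx (hs.eq_of_left hfix).symm
    omega
  · have := numCycles_le_swap_mul_add_one (swap w x * (G.edge c).trans π.symm) w x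
    rw [← mul_assoc, swap_mul_self, one_mul] at this
    omega

/-! ### Isomorphisms -/

/-- Color-preserving isomorphisms as data. -/
structure IsoData (G H : ColoredGraph d) where
  white : G.White ≃ H.White
  black : G.Black ≃ H.Black
  edge : ∀ c w, H.edge c (white w) = black (G.edge c w)

namespace IsoData

variable {G H : ColoredGraph d}

/-- Transport of pairings along an isomorphism. -/
def pairing (e : IsoData G H) : (G.White ≃ G.Black) ≃ (H.White ≃ H.Black) :=
  Equiv.equivCongr e.white e.black

theorem pairing_apply (e : IsoData G H) (π : G.White ≃ G.Black) (w : G.White) :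
    e.pairing π (e.white w) = e.black (π w) := by
  simp [pairing]

theorem totalCycles_pairing (e : IsoData G H) (π : G.White ≃ G.Black) :
    H.totalCycles (e.pairing π) = G.totalCycles π := by
  unfold totalCycles
  refine Finset.sum_congr rfl fun c _ => ?_
  rw [bicoloredCycles_eq, bicoloredCycles_eq]
  refine numCycles_conj e.white fun x => ?_
  simp [Equiv.symm_apply_eq, e.edge, pairing_apply]

def symm (e : IsoData G H) : IsoData H G where
  white := e.white.symm
  black := e.black.symm
  edge c w := by
    obtain ⟨w, rfl⟩ := e.white.surjective w
    simp [e.edge]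

end IsoData

/-! ### Constructions of contractions -/

/-- Every pair of a white and a black vertex can be contracted. -/
theorem exists_contraction (G : ColoredGraph d) (w : G.White) (k : G.Black) :
    ∃ G', Nonempty (Contraction G G' w k) := by
  let ew := Equiv.optionSubtypeNe w
  let ek := Equiv.optionSubtypeNe k
  refine ⟨⟨{x // x ≠ w}, {y // y ≠ k},
    fun c => Equiv.removeNone (ew.trans ((G.edge c).trans ek.symm))⟩,
    ⟨⟨ew, ek, by simp [ew], by simp [ek], fun c x => ?_⟩⟩⟩
  set ρ := ew.trans ((G.edge c).trans ek.symm)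
  have hρ : ∀ y, G.edge c (ew y) = ek (ρ y) := fun y => by simp [ρ]
  have hk : ek none = k := by simp [ek]
  have hw : ew none = w := by simp [ew]
  cases hx : ρ (some x) with
  | none =>
    right
    refine ⟨by rw [hρ, hx, hk], ?_⟩
    -- Since `x` was joined to the deleted `k`, `removeNone` joins it to the former neighbor of `w`.
    have := hρ none
    rw [hw, ← Equiv.removeNone_none ρ hx] at this
    exact this
  | some y =>
    left
    rw [hρ, ← Equiv.removeNone_some ρ ⟨y, hx⟩]

/-- Moving `none` to the left summand. -/
def optionSumLeft (X Y : Type) : Option (X ⊕ Y) ≃ Option X ⊕ Y where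
  toFun
    | none => Sum.inl none
    | some (Sum.inl x) => Sum.inl (some x)
    | some (Sum.inr y) => Sum.inr y
  invFun
    | Sum.inl none => none
    | Sum.inl (some x) => some (Sum.inl x)
    | Sum.inr y => some (Sum.inr y)
  left_inv := by rintro (_ | x | y) <;> rfl
  right_inv := by rintro ((_ | x) | y) <;> rfl

/-- Moving `none` to the right summand. -/
def optionSumRight (X Y : Type) : Option (X ⊕ Y) ≃ X ⊕ Option Y where
  toFun
    | none => Sum.inr none
    | some (Sum.inl x) => Sum.inl x
    | some (Sum.inr y) => Sum.inr (some y)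
  invFun
    | Sum.inr none => none
    | Sum.inl x => some (Sum.inl x)
    | Sum.inr (some y) => some (Sum.inr y)
  left_inv := by rintro (_ | x | y) <;> rfl
  right_inv := by rintro (x | (_ | y)) <;> rfl

namespace Contraction

variable {G G' : ColoredGraph d} {w : G.White} {k : G.Black}

def disjUnionRight (κ : Contraction G G' w k) (H : ColoredGraph d) :
    Contraction (G.disjUnion H) (G'.disjUnion H) (Sum.inl w) (Sum.inl k) where
  white := (optionSumLeft _ _).trans (Equiv.sumCongr κ.white (Equiv.refl _))
  black := (optionSumLeft _ _).trans (Equiv.sumCongr κ.black (Equiv.refl _))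
  white_none := congrArg Sum.inl κ.white_none
  black_none := congrArg Sum.inl κ.black_none
  edge := by
    rintro c (x | y)
    · rcases κ.edge c x with h | ⟨h, h'⟩
      · exact Or.inl (congrArg Sum.inl h)
      · exact Or.inr ⟨congrArg Sum.inl h, congrArg Sum.inl h'⟩
    · exact Or.inl rfl

def disjUnionLeft (κ : Contraction G G' w k) (H : ColoredGraph d) :
    Contraction (H.disjUnion G) (H.disjUnion G') (Sum.inr w) (Sum.inr k) where
  white := (optionSumRight _ _).trans (Equiv.sumCongr (Equiv.refl _) κ.white)
  black := (optionSumRight _ _).trans (Equiv.sumCongr (Equiv.refl _) κ.black)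
  white_none := congrArg Sum.inr κ.white_none
  black_none := congrArg Sum.inr κ.black_none
  edge := by
    rintro c (x | y)
    · exact Or.inl rfl
    · rcases κ.edge c y with h | ⟨h, h'⟩
      · exact Or.inl (congrArg Sum.inr h)
      · exact Or.inr ⟨congrArg Sum.inr h, congrArg Sum.inr h'⟩

def ofIso {H : ColoredGraph d} (e : IsoData H G) {w : H.White} {k : H.Black}
    (κ : Contraction G G' (e.white w) (e.black k)) : Contraction H G' w k where
  white := κ.white.trans e.white.symm
  black := κ.black.trans e.black.symm
  white_none := by simp [κ.white_none]
  black_none := by simp [κ.black_none]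
  edge c x := by
    have h1 : ∀ y, H.edge c (e.white.symm y) = e.black.symm (G.edge c y) := fun y => by
      rw [Equiv.eq_symm_apply, ← e.edge]; simp
    simp only [Equiv.trans_apply, h1, Equiv.apply_eq_iff_eq, Equiv.symm_apply_eq]
    simp only [Equiv.eq_symm_apply, ← e.edge]
    exact κ.edge c x

end Contraction

theorem insertAtWhite_edge_of_mem (B : ColoredGraph d) (u : B.White) {C : Finset (Fin d)}
    {c : Fin d} (hc : c ∈ C) (x : Option B.White) :
    (B.insertAtWhite u C).edge c x = Option.map (B.edge c) (swap none (some u) x) := by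
  exact DFunLike.congr_fun (show (B.insertAtWhite u C).edge c =
    ((swap none (some u)).trans (Equiv.optionCongr (B.edge c)) : Option B.White ≃ Option B.Black)
    from if_pos hc) x

theorem insertAtWhite_edge_of_notMem (B : ColoredGraph d) (u : B.White) {C : Finset (Fin d)}
    {c : Fin d} (hc : c ∉ C) (x : Option B.White) :
    (B.insertAtWhite u C).edge c x = Option.map (B.edge c) x := by
  exact DFunLike.congr_fun (show (B.insertAtWhite u C).edge c =
    (Equiv.optionCongr (B.edge c) : Option B.White ≃ Option B.Black) from if_neg hc) x

theorem insertAtBlack_edge_of_mem (B : ColoredGraph d) (u : B.Black) {C : Finset (Fin d)}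
    {c : Fin d} (hc : c ∈ C) (x : Option B.White) :
    (B.insertAtBlack u C).edge c x = swap none (some u) (Option.map (B.edge c) x) := by
  exact DFunLike.congr_fun (show (B.insertAtBlack u C).edge c =
    ((Equiv.optionCongr (B.edge c)).trans (swap none (some u)) : Option B.White ≃ Option B.Black)
    from if_pos hc) x

theorem insertAtBlack_edge_of_notMem (B : ColoredGraph d) (u : B.Black) {C : Finset (Fin d)}
    {c : Fin d} (hc : c ∉ C) (x : Option B.White) :
    (B.insertAtBlack u C).edge c x = Option.map (B.edge c) x := by
  exact DFunLike.congr_fun (show (B.insertAtBlack u C).edge c =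
    (Equiv.optionCongr (B.edge c) : Option B.White ≃ Option B.Black) from if_neg hc) x

/-- Contraction undoes a bidipole insertion. This is what makes induction along `BuiltBy` possible.
-/
def insertAtWhite_contraction (B : ColoredGraph d) (u : B.White) (C : Finset (Fin d)) :
    Contraction (B.insertAtWhite u C) B none none where
  white := Equiv.refl (Option B.White)
  black := Equiv.refl (Option B.Black)
  white_none := rfl
  black_none := rfl
  edge c x := by
    change (B.insertAtWhite u C).edge c (some x) = some (B.edge c x) ∨
      ((B.insertAtWhite u C).edge c (some x) = none ∧
        (B.insertAtWhite u C).edge c none = some (B.edge c x))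
    by_cases hc : c ∈ C
    · rw [insertAtWhite_edge_of_mem B u hc, insertAtWhite_edge_of_mem B u hc, swap_apply_left]
      by_cases hx : x = u
      · right; rw [hx, swap_apply_right]; exact ⟨rfl, rfl⟩
      · left; rw [swap_apply_of_ne_of_ne (by simp) (by simpa using hx)]; rfl
    · left; rw [insertAtWhite_edge_of_notMem B u hc]; rfl

def insertAtBlack_contraction (B : ColoredGraph d) (u : B.Black) (C : Finset (Fin d)) :
    Contraction (B.insertAtBlack u C) B none none where
  white := Equiv.refl (Option B.White)
  black := Equiv.refl (Option B.Black)
  white_none := rfl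
  black_none := rfl
  edge c x := by
    change (B.insertAtBlack u C).edge c (some x) = some (B.edge c x) ∨
      ((B.insertAtBlack u C).edge c (some x) = none ∧
        (B.insertAtBlack u C).edge c none = some (B.edge c x))
    by_cases hc : c ∈ C
    · rw [insertAtBlack_edge_of_mem B u hc, insertAtBlack_edge_of_mem B u hc, Option.map_none,
        swap_apply_left, Option.map_some]
      by_cases hx : B.edge c x = u
      · right; rw [hx, swap_apply_right]; exact ⟨rfl, rfl⟩
      · left; rw [swap_apply_of_ne_of_ne (by simp) (by simpa using hx)]
    · left; rw [insertAtBlack_edge_of_notMem B u hc]; rfl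

/-- The two new vertices share the colors outside `C`. For an unbalanced insertion these are more
than half of the colors. -/
theorem loops_insertAtWhite (B : ColoredGraph d) (u : B.White) (C : Finset (Fin d)) :
    (B.insertAtWhite u C).loops (none : Option B.White) (none : Option B.Black) = d - C.card := by
  have hd : d - C.card = Cᶜ.card := by rw [Finset.card_compl, Fintype.card_fin]
  rw [hd]
  refine loops_eq_card fun c => ?_
  rw [Finset.mem_compl]
  by_cases hc : c ∈ C
  · rw [insertAtWhite_edge_of_mem B u hc, swap_apply_left]
    exact ⟨fun h => absurd h (Option.some_ne_none _), fun h => absurd hc h⟩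
  · rw [insertAtWhite_edge_of_notMem B u hc]
    exact ⟨fun _ => hc, fun _ => rfl⟩

theorem loops_insertAtBlack (B : ColoredGraph d) (u : B.Black) (C : Finset (Fin d)) :
    (B.insertAtBlack u C).loops (none : Option B.White) (none : Option B.Black) = d - C.card := by
  have hd : d - C.card = Cᶜ.card := by rw [Finset.card_compl, Fintype.card_fin]
  rw [hd]
  refine loops_eq_card fun c => ?_
  rw [Finset.mem_compl]
  by_cases hc : c ∈ C
  · rw [insertAtBlack_edge_of_mem B u hc, Option.map_none, swap_apply_left]
    exact ⟨fun h => absurd h (Option.some_ne_none _), fun h => absurd hc h⟩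
  · rw [insertAtBlack_edge_of_notMem B u hc]
    exact ⟨fun _ => hc, fun _ => rfl⟩

end ColoredGraph

namespace ColoredGraph

variable {d : ℕ}

open Equiv Equiv.Perm

/-! ### Pairings of disjoint unions -/

section disjUnion

variable {A B : ColoredGraph d}

def inlW (a : A.White) : (A.disjUnion B).White := Sum.inl a
def inrW (b : B.White) : (A.disjUnion B).White := Sum.inr b
def inlB (a : A.Black) : (A.disjUnion B).Black := Sum.inl a
def inrB (b : B.Black) : (A.disjUnion B).Black := Sum.inr b

theorem white_cases (x : (A.disjUnion B).White) : (∃ a, x = inlW a) ∨ ∃ b, x = inrW b := by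
  rcases x with x | x
  · exact Or.inl ⟨x, rfl⟩
  · exact Or.inr ⟨x, rfl⟩

theorem black_cases (x : (A.disjUnion B).Black) : (∃ a, x = inlB a) ∨ ∃ b, x = inrB b := by
  rcases x with x | x
  · exact Or.inl ⟨x, rfl⟩
  · exact Or.inr ⟨x, rfl⟩

@[simp] theorem inlW_inj {a a' : A.White} : (inlW a : (A.disjUnion B).White) = inlW a' ↔ a = a' :=
  Sum.inl_injective.eq_iff
@[simp] theorem inrW_inj {b b' : B.White} : (inrW b : (A.disjUnion B).White) = inrW b' ↔ b = b' :=
  Sum.inr_injective.eq_iff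
@[simp] theorem inlB_inj {a a' : A.Black} : (inlB a : (A.disjUnion B).Black) = inlB a' ↔ a = a' :=
  Sum.inl_injective.eq_iff
@[simp] theorem inrB_inj {b b' : B.Black} : (inrB b : (A.disjUnion B).Black) = inrB b' ↔ b = b' :=
  Sum.inr_injective.eq_iff
@[simp] theorem inlW_ne_inrW {a : A.White} {b : B.White} :
    (inlW a : (A.disjUnion B).White) ≠ inrW b := Sum.inl_ne_inr
@[simp] theorem inrW_ne_inlW {a : A.White} {b : B.White} :
    (inrW b : (A.disjUnion B).White) ≠ inlW a := Sum.inr_ne_inl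
@[simp] theorem inlB_ne_inrB {a : A.Black} {b : B.Black} :
    (inlB a : (A.disjUnion B).Black) ≠ inrB b := Sum.inl_ne_inr
@[simp] theorem inrB_ne_inlB {a : A.Black} {b : B.Black} :
    (inrB b : (A.disjUnion B).Black) ≠ inlB a := Sum.inr_ne_inl

@[simp] theorem disjUnion_edge_inlW (c : Fin d) (a : A.White) :
    (A.disjUnion B).edge c (inlW a) = inlB (A.edge c a) := rfl
@[simp] theorem disjUnion_edge_inrW (c : Fin d) (b : B.White) :
    (A.disjUnion B).edge c (inrW b) = inrB (B.edge c b) := rfl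

/-- The disjoint union of two pairings. -/
def sumPairing (π : A.White ≃ A.Black) (ρ : B.White ≃ B.Black) :
    (A.disjUnion B).White ≃ (A.disjUnion B).Black :=
  Equiv.sumCongr π ρ

@[simp] theorem sumPairing_inlW (π : A.White ≃ A.Black) (ρ : B.White ≃ B.Black) (a : A.White) :
    sumPairing π ρ (inlW a) = inlB (π a) := rfl

@[simp] theorem sumPairing_inrW (π : A.White ≃ A.Black) (ρ : B.White ≃ B.Black) (b : B.White) :
    sumPairing π ρ (inrW b) = inrB (ρ b) := rfl

theorem totalCycles_sumPairing (π : A.White ≃ A.Black) (ρ : B.White ≃ B.Black) :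
    (A.disjUnion B).totalCycles (sumPairing π ρ) = A.totalCycles π + B.totalCycles ρ := by
  unfold totalCycles
  rw [← Finset.sum_add_distrib]
  refine Finset.sum_congr rfl fun c _ => ?_
  refine Eq.trans (congrArg numCycles ?_)
    (numCycles_sumCongr ((A.edge c).trans π.symm) ((B.edge c).trans ρ.symm))
  refine Equiv.ext fun x => ?_
  obtain ⟨x, rfl⟩ | ⟨x, rfl⟩ := white_cases x <;> rfl

/-- The pairing of `A ⊔ B` that pairs `a` with `ρ b` and `b` with `π a`, and the other vertices of
`A` and of `B` as `π` and `ρ` do. -/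
def glue (π : A.White ≃ A.Black) (ρ : B.White ≃ B.Black) (a : A.White)
    (b : B.White) : (A.disjUnion B).White ≃ (A.disjUnion B).Black :=
  (swap (inlW a) (inrW b)).trans (sumPairing π ρ)

section glue

variable (π : A.White ≃ A.Black) (ρ : B.White ≃ B.Black) (a : A.White) (b : B.White)

theorem glue_inl_self : glue π ρ a b (inlW a) = inrB (ρ b) := by
  simp [glue]

theorem glue_inr_self : glue π ρ a b (inrW b) = inlB (π a) := by
  simp [glue]

theorem glue_inl {x : A.White} (hx : x ≠ a) : glue π ρ a b (inlW x) = inlB (π x) := by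
  simp [glue, swap_apply_of_ne_of_ne, hx]

theorem glue_inr {x : B.White} (hx : x ≠ b) : glue π ρ a b (inrW x) = inrB (ρ x) := by
  simp [glue, swap_apply_of_ne_of_ne, hx]

/-- Before the exchange, the cycles through `a` and `b` lie in different components. The
transposition merges them, for each of the `d` colors. -/
theorem totalCycles_glue : (A.disjUnion B).totalCycles (glue π ρ a b) + d =
    A.totalCycles π + B.totalCycles ρ := by
  rw [← totalCycles_sumPairing]
  unfold totalCycles
  have hd : ∀ f : Fin d → ℕ, ∑ c, f c + d = ∑ c, (f c + 1) := fun f => by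
    simp [Finset.sum_add_distrib]
  rw [hd]
  refine Finset.sum_congr rfl fun c _ => ?_
  rw [bicoloredCycles_eq, bicoloredCycles_eq]
  refine numCycles_swap_mul_add_one
    (σ := ((A.disjUnion B).edge c).trans (sumPairing π ρ).symm) fun h => ?_
  have := h.map_eq (f := Sum.isLeft) fun x => by
    rcases x with x | x <;> rfl
  exact absurd this (by simp [inlW, inrW])

theorem glue_injective {π π' : A.White ≃ A.Black} (h : glue π ρ a b = glue π' ρ a b) :
    π = π' := by
  ext x
  have h1 := fun y => DFunLike.congr_fun h y
  by_cases hx : x = a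
  · have := h1 (inrW b)
    rw [glue_inr_self, glue_inr_self, inlB_inj] at this
    rw [hx, this]
  · have := h1 (inlW x)
    rwa [glue_inl _ _ _ _ hx, glue_inl _ _ _ _ hx, inlB_inj] at this

end glue

theorem exists_eq_sumPairing {π : (A.disjUnion B).White ≃ (A.disjUnion B).Black}
    (h₁ : ∀ x, ∃ x', π (inlW x) = inlB x') (h₂ : ∀ y, ∃ y', π (inrW y) = inrB y') :
    ∃ π₁ π₂, π = sumPairing π₁ π₂ := by
  choose f hf using h₁
  choose g hg using h₂
  have hfb : Function.Bijective f := by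
    refine ⟨fun x y h => ?_, fun x' => ?_⟩
    · exact inlW_inj.1 (π.injective (by rw [hf, hf, h]))
    · obtain ⟨x, h⟩ := π.surjective (inlB x')
      obtain ⟨x, rfl⟩ | ⟨x, rfl⟩ := white_cases x
      · exact ⟨x, inlB_inj.1 ((hf x).symm.trans h)⟩
      · rw [hg] at h; exact absurd h inrB_ne_inlB
  have hgb : Function.Bijective g := by
    refine ⟨fun x y h => ?_, fun x' => ?_⟩
    · exact inrW_inj.1 (π.injective (by rw [hg, hg, h]))
    · obtain ⟨x, h⟩ := π.surjective (inrB x')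
      obtain ⟨x, rfl⟩ | ⟨x, rfl⟩ := white_cases x
      · rw [hf] at h; exact absurd h inlB_ne_inrB
      · exact ⟨x, inrB_inj.1 ((hg x).symm.trans h)⟩
  refine ⟨Equiv.ofBijective f hfb, Equiv.ofBijective g hgb, ?_⟩
  refine Equiv.ext fun x => ?_
  obtain ⟨x, rfl⟩ | ⟨x, rfl⟩ := white_cases x
  · rw [hf]; rfl
  · rw [hg]; rfl

theorem card_white_eq_card_black (hd : 0 < d) (G : ColoredGraph d) :
    Fintype.card G.White = Fintype.card G.Black :=
  Fintype.card_congr (G.edge ⟨0, hd⟩)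

/-- `A` has equally many white and black vertices, so if its white vertices are paired inside `A`
they use up all its black ones. -/
theorem exists_inrW_of_inlW (hd : 0 < d) {π : (A.disjUnion B).White ≃ (A.disjUnion B).Black}
    (h₁ : ∀ x, ∃ x', π (inlW x) = inlB x') : ∀ y, ∃ y', π (inrW y) = inrB y' := by
  choose f hf using h₁
  have hfb : Function.Bijective f := (Fintype.bijective_iff_injective_and_card f).2
    ⟨fun x y h => inlW_inj.1 (π.injective (by rw [hf, hf, h])), card_white_eq_card_black hd A⟩
  intro y
  obtain ⟨x', h⟩ | ⟨y', h⟩ := black_cases (π (inrW y))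
  · obtain ⟨x, rfl⟩ := hfb.2 x'
    rw [← hf] at h
    exact absurd (π.injective h) inrW_ne_inlW
  · exact ⟨y', h⟩

/-- A pairing of `A ⊔ B` without edges of color 0 between `A` and `B`. -/
theorem exists_eq_sumPairing_of_not_cross (hd : 0 < d)
    {π : (A.disjUnion B).White ≃ (A.disjUnion B).Black}
    (h : ¬ ∃ w k, π (inlW w) = inrB k) :
    ∃ (π₁ : A.White ≃ A.Black) (π₂ : B.White ≃ B.Black), π = sumPairing π₁ π₂ := by
  have h₁ : ∀ x : A.White, ∃ x' : A.Black, π (inlW x) = inlB x' := by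
    intro x
    obtain ⟨x', hx⟩ | ⟨y', hx⟩ := black_cases (π (inlW x))
    · exact ⟨x', hx⟩
    · exact absurd ⟨x, y', hx⟩ h
  exact exists_eq_sumPairing h₁ (exists_inrW_of_inlW hd h₁)

end disjUnion

namespace Contraction

variable {G G' : ColoredGraph d} {w : G.White} {k : G.Black}

theorem extend_swap (κ : Contraction G G' w k) (x y : G'.White) (π : G'.White ≃ G'.Black) :
    κ.extend ((swap x y).trans π) =
      (swap (κ.white (some x)) (κ.white (some y))).trans (κ.extend π) := by
  ext z
  obtain ⟨z, rfl⟩ := κ.white.surjective z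
  have hinj : Function.Injective fun x => κ.white (some x) :=
    κ.white.injective.comp (Option.some_injective _)
  cases z with
  | none =>
    rw [Equiv.trans_apply, swap_apply_of_ne_of_ne (by simp) (by simp), κ.white_none, extend_apply,
      extend_apply]
  | some z =>
    have h1 : swap (κ.white (some x)) (κ.white (some y)) (κ.white (some z)) =
        κ.white (some (swap x y z)) := (hinj.swap_apply x y z)
    rw [Equiv.trans_apply, h1, extend_white_some, extend_white_some]
    rfl

/-- The contraction of `A ⊔ G` induced by a contraction of `G`. -/
def inr (κ : Contraction G G' w k) (A : ColoredGraph d) :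
    Contraction (A.disjUnion G) (A.disjUnion G') (inrW w) (inrB k) := κ.disjUnionLeft A

/-- The contraction of `G ⊔ H` induced by a contraction of `G`. -/
def inl (κ : Contraction G G' w k) (H : ColoredGraph d) :
    Contraction (G.disjUnion H) (G'.disjUnion H) (inlW w) (inlB k) := κ.disjUnionRight H

theorem inr_white_inlW (κ : Contraction G G' w k) (A : ColoredGraph d) (a : A.White) :
    (κ.inr A).white (some (inlW a)) = inlW a := rfl

theorem inr_white_inrW (κ : Contraction G G' w k) (A : ColoredGraph d) (x : G'.White) :
    (κ.inr A).white (some (inrW x)) = inrW (κ.white (some x)) := rfl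

theorem inr_black_inlB (κ : Contraction G G' w k) (A : ColoredGraph d) (a : A.Black) :
    (κ.inr A).black (some (inlB a)) = inlB a := rfl

theorem inr_black_inrB (κ : Contraction G G' w k) (A : ColoredGraph d) (x : G'.Black) :
    (κ.inr A).black (some (inrB x)) = inrB (κ.black (some x)) := rfl

theorem inr_extend_sumPairing (κ : Contraction G G' w k) (A : ColoredGraph d)
    (π : A.White ≃ A.Black) (ρ : G'.White ≃ G'.Black) :
    (κ.inr A).extend (sumPairing π ρ) = sumPairing π (κ.extend ρ) := by
  refine Equiv.ext fun x => ?_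
  obtain ⟨x, rfl⟩ := (κ.inr A).white.surjective x
  cases x with
  | none => rw [(κ.inr A).white_none, extend_apply, sumPairing_inrW, extend_apply]
  | some x =>
    rw [extend_white_some]
    obtain ⟨x, rfl⟩ | ⟨x, rfl⟩ := white_cases x
    · rfl
    · rw [inr_white_inrW, sumPairing_inrW, sumPairing_inrW, extend_white_some, inr_black_inrB]

theorem inr_extend_glue (κ : Contraction G G' w k) (A : ColoredGraph d)
    (π : A.White ≃ A.Black) (ρ : G'.White ≃ G'.Black) (a : A.White) (b : G'.White) :
    (κ.inr A).extend (glue π ρ a b) = glue π (κ.extend ρ) a (κ.white (some b)) := by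
  unfold glue
  rw [← inr_extend_sumPairing, extend_swap, inr_white_inlW, inr_white_inrW]

end Contraction

theorem loops_disjUnion_inr (A B : ColoredGraph d) (w : B.White) (k : B.Black) :
    (A.disjUnion B).loops (inrW w) (inrB k) = B.loops w k :=
  loops_eq_card fun c => by simp

theorem loops_disjUnion_inl (A B : ColoredGraph d) (w : A.White) (k : A.Black) :
    (A.disjUnion B).loops (inlW w) (inlB k) = A.loops w k :=
  loops_eq_card fun c => by simp

theorem loops_disjUnion_inl_inr (A B : ColoredGraph d) (w : A.White) (k : B.Black) :
    (A.disjUnion B).loops (inlW w) (inrB k) = 0 := by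
  rw [← Finset.card_empty]
  exact loops_eq_card fun c => by simp

/-! ### Tightness of totally unbalanced generalized melonic bubbles. -/

/-- Every set of vertices closed under the colored edges is empty or everything. -/
def Linked (G : ColoredGraph d) : Prop :=
  ∀ (p : G.White → Prop) (q : G.Black → Prop), (∀ c w, p w ↔ q (G.edge c w)) →
    ∀ x y, p x ↔ p y

/-- The extremal properties of totally unbalanced generalized melonic bubbles: there is a single
pairing `ρ` maximizing the number of bicolored cycles, and the optimal way of connecting the bubble
to other ones is to cut a single edge of `ρ`. -/
structure Tight (B : ColoredGraph d) (ω : ℕ) (ρ : B.White ≃ B.Black) : Prop where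
  linked : B.Linked
  cycles : B.totalCycles ρ = ω
  lt : ∀ τ, τ ≠ ρ → B.totalCycles τ < ω
  cross : ∀ (A : ColoredGraph d) (π : (A.disjUnion B).White ≃ (A.disjUnion B).Black) w k,
    π (inlW w) = inrB k → ∃ (π' : A.White ≃ A.Black) (a : A.White) (b : B.White),
      (A.disjUnion B).totalCycles π + d ≤ A.totalCycles π' + ω ∧
      ((A.disjUnion B).totalCycles π + d = A.totalCycles π' + ω → π = glue π' ρ a b)

theorem Tight.le {B : ColoredGraph d} {ω : ℕ} {ρ : B.White ≃ B.Black} (h : B.Tight ω ρ)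
    (τ : B.White ≃ B.Black) : B.totalCycles τ ≤ ω := by
  by_cases hτ : τ = ρ
  · rw [hτ, h.cycles]
  · exact (h.lt τ hτ).le

instance : Unique (twoVertex d).White := inferInstanceAs (Unique Unit)
instance : Unique (twoVertex d).Black := inferInstanceAs (Unique Unit)

theorem totalCycles_twoVertex (ρ : (twoVertex d).White ≃ (twoVertex d).Black) :
    (twoVertex d).totalCycles ρ = d := by
  unfold totalCycles
  have : ∀ c, (twoVertex d).bicoloredCycles ρ c = 1 := fun c => by
    rw [bicoloredCycles_eq, numCycles_eq_card (γ := Unit) (f := fun _ => ())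
      (fun _ => ⟨default, rfl⟩) (fun _ => rfl)
      (fun x y _ => (Subsingleton.elim x y).sameCycle _), Nat.card_unique]
  simp [this]

/-- A single exchange at the only white vertex turns a crossing pairing into a split one. Every
crossing pairing is thus a `glue`, and the bound is an equality. -/
theorem tight_twoVertex (ρ : (twoVertex d).White ≃ (twoVertex d).Black) :
    (twoVertex d).Tight d ρ where
  linked p _ _ x y := by rw [Subsingleton.elim x y]
  cycles := totalCycles_twoVertex ρ
  lt τ hτ := absurd (Equiv.ext fun _ => Subsingleton.elim _ _) hτ
  cross A π w k hwk := by
    set u : (twoVertex d).White := default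
    let π' := (swap (inlW w) (inrW u)).trans π
    have hr : π' (inrW u) = inrB k := by simp [π', hwk]
    have hl : ∀ x, ∃ x', π' (inlW x) = inlB x' := by
      intro x
      obtain ⟨x', hx⟩ | ⟨y, hx⟩ := black_cases (π' (inlW x))
      · exact ⟨x', hx⟩
      · rw [Subsingleton.elim y k, ← hr] at hx
        exact absurd (π'.injective hx) inlW_ne_inrW
    obtain ⟨π₁, π₂, h⟩ := exists_eq_sumPairing hl fun y => ⟨k, by
      rw [Subsingleton.elim y u]; exact hr⟩
    have h₂ : π₂ = ρ := Equiv.ext fun _ => Subsingleton.elim _ _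
    have hπ : π = glue π₁ ρ w u := by
      unfold glue
      rw [← h₂, ← h]
      ext x
      simp [π']
    refine ⟨π₁, w, u, ?_, fun _ => hπ⟩
    rw [hπ, totalCycles_glue, totalCycles_twoVertex]

/-- A color joining `v` to `k` keeps these two on the same side, and a color leaving `v` elsewhere
attaches them to the rest. -/
theorem Contraction.linked {B B₀ : ColoredGraph d} {v : B.White} {k : B.Black}
    (κ : Contraction B B₀ v k) (h : B₀.Linked) (h₁ : ∃ c, B.edge c v = k)
    (h₂ : ∃ c, B.edge c v ≠ k) : B.Linked := by
  intro p q hpq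
  obtain ⟨c₁, h₁⟩ := h₁
  obtain ⟨c₂, h₂⟩ := h₂
  have hvk : p v ↔ q k := by rw [hpq c₁, h₁]
  have h0 := h (fun x => p (κ.white (some x))) (fun y => q (κ.black (some y))) fun c x => by
    rcases κ.edge c x with h | ⟨h, h'⟩
    · rw [hpq c, h]
    · rw [hpq c, h, ← hvk, hpq c, h']
  obtain ⟨y, hy⟩ : ∃ y, B.edge c₂ v = κ.black (some y) := by
    obtain ⟨y, hy⟩ := κ.black.surjective (B.edge c₂ v)
    cases y with
    | none => exact absurd (hy.symm.trans κ.black_none) h₂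
    | some y => exact ⟨y, hy.symm⟩
  let z := (B₀.edge c₂).symm y
  have hz : p v ↔ p (κ.white (some z)) := by
    rcases κ.edge c₂ z with h | ⟨h, h'⟩
    · rw [hpq c₂ v, hy, hpq c₂ (κ.white _), h]
      simp [z]
    · rw [hpq c₂ (κ.white _), h, hvk]
  have hall : ∀ x, p x ↔ p v := by
    intro x
    obtain ⟨x, rfl⟩ := κ.white.surjective x
    cases x with
    | none => rw [κ.white_none]
    | some x => rw [hz]; exact h0 x z
  intro x y
  rw [hall x, hall y]

/-- As `v` and `k` share more than half of the colors, a pairing that separates them strictly gains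
cycles when they are paired with each other by one exchange (`totalCycles_swap_le`). After that,
contracting reduces everything to `B₀`. The subtle case is an exchange that destroys the crossing
between `A` and `B`. -/
theorem Tight.contraction (hd : 0 < d) {B B₀ : ColoredGraph d} {ω : ℕ} {ρ : B₀.White ≃ B₀.Black}
    (h : B₀.Tight ω ρ) {v : B.White} {k : B.Black} (κ : Contraction B B₀ v k)
    (hl : d < 2 * B.loops v k) (hld : B.loops v k < d) :
    B.Tight (ω + B.loops v k) (κ.extend ρ) := by
  have hlt : ∀ τ, τ ≠ κ.extend ρ → B.totalCycles τ < ω + B.loops v k := by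
    intro τ hτ
    by_cases hvk : τ v = k
    · obtain ⟨τ₀, rfl⟩ := κ.exists_extend_eq hvk
      rw [κ.totalCycles_extend]
      have := h.lt τ₀ fun h0 => hτ (by rw [h0])
      omega
    · set x := τ.symm k
      have hx : x ≠ v := fun h0 => hvk (by rw [← h0]; simp [x])
      have hτ' : ((swap v x).trans τ) v = k := by simp [x]
      have := totalCycles_swap_le hτ' hx
      have hτ2 : (swap v x).trans ((swap v x).trans τ) = τ := by ext; simp
      rw [hτ2] at this
      obtain ⟨τ₀, h0⟩ := κ.exists_extend_eq hτ'
      rw [← h0, κ.totalCycles_extend] at this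
      have := h.le τ₀
      omega
  refine ⟨κ.linked h.linked ?_ ?_, by rw [κ.totalCycles_extend, h.cycles], hlt, ?_⟩
  · by_contra! hne
    have : B.loops v k = (∅ : Finset (Fin d)).card := loops_eq_card fun c => by simp [hne]
    simp at this
    omega
  · by_contra! hne
    have : B.loops v k = (Finset.univ : Finset (Fin d)).card := loops_eq_card fun c => by
      simp [hne]
    simp at this
    omega
  intro A π w y hwy
  let K := κ.inr A
  have hloops := loops_disjUnion_inr A B v k
  have hcross : ∀ {π₀ : (A.disjUnion B₀).White ≃ (A.disjUnion B₀).Black},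
      K.extend π₀ = π → ∃ w k, π₀ (inlW w) = inrB k := by
    intro π₀ h0
    obtain ⟨x', hx⟩ | ⟨y', hx⟩ := black_cases (π₀ (inlW w))
    · have := K.extend_white_some π₀ (inlW w)
      rw [h0, hx, κ.inr_white_inlW, κ.inr_black_inlB, hwy] at this
      exact absurd this inrB_ne_inlB
    · exact ⟨w, y', hx⟩
  by_cases hvk : π (inrW v) = inrB k
  · obtain ⟨π₀, hπ₀⟩ := K.exists_extend_eq hvk
    obtain ⟨w', k', hwk'⟩ := hcross hπ₀
    obtain ⟨π', a, b, hle, heq⟩ := h.cross A π₀ w' k' hwk'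
    have ht := K.totalCycles_extend π₀
    rw [hπ₀, hloops] at ht
    refine ⟨π', a, κ.white (some b), by omega, fun h1 => ?_⟩
    rw [← hπ₀, heq (by omega)]
    exact κ.inr_extend_glue A π' ρ a b
  · obtain ⟨x, hxdef⟩ : ∃ x, x = π.symm (inrB k) := ⟨_, rfl⟩
    have hπx : π x = inrB k := by rw [hxdef]; simp
    have hx : x ≠ inrW v := fun h0 => hvk (by rw [← h0, hπx])
    have hπ' : ((swap (inrW v) x).trans π) (inrW v) = inrB k := by simp [hπx]
    have hle := totalCycles_swap_le hπ' hx
    have hπ2 : (swap (inrW v) x).trans ((swap (inrW v) x).trans π) = π := by ext; simp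
    rw [hπ2, hloops] at hle
    obtain ⟨π₀, h0⟩ := K.exists_extend_eq hπ'
    rw [← h0, K.totalCycles_extend, hloops] at hle
    -- If the crossing survives the exchange, the strict gain makes the inequality strict and
    -- equality is impossible.
    by_cases hc : ∃ w k, π₀ (inlW w) = inrB k
    · obtain ⟨w', k', hwk'⟩ := hc
      obtain ⟨π', a, b, hle', -⟩ := h.cross A π₀ w' k' hwk'
      exact ⟨π', a, κ.white (some b), by omega, by omega⟩
    · obtain ⟨π₁, τ₀, h1⟩ := exists_eq_sumPairing_of_not_cross hd hc
      have hπ'' : K.extend π₀ = sumPairing π₁ (κ.extend τ₀) := by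
        rw [h1]
        exact κ.inr_extend_sumPairing A π₁ τ₀
      rw [← h0, hπ''] at hπ2
      obtain ⟨a, rfl⟩ | ⟨b, rfl⟩ := white_cases x
      -- The crossing was lost, so `π` itself is a `glue` and loses exactly `d` cycles. Equality
      -- then forces the pairing on `B` to be the unique optimal one.
      · have hπ : π = glue π₁ (κ.extend τ₀) a v := by
          rw [← hπ2]
          unfold glue
          rw [swap_comm]
        refine ⟨π₁, a, v, ?_, fun h2 => ?_⟩
        · rw [hπ, totalCycles_glue, κ.totalCycles_extend]
          have := h.le τ₀
          omega
        · rw [hπ, totalCycles_glue] at h2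
          have : κ.extend τ₀ = κ.extend ρ := by
            by_contra hne
            have := hlt _ hne
            omega
          rw [hπ, this]
      -- An exchange inside `B` cannot remove the edge from `w` to `B`.
      · exfalso
        have h3 := DFunLike.congr_fun hπ2 (inlW w)
        rw [hwy, Equiv.trans_apply, swap_apply_of_ne_of_ne inlW_ne_inrW inlW_ne_inrW] at h3
        exact inlB_ne_inrB h3

namespace IsoData

variable {G H : ColoredGraph d}

def disjUnion {G' H' : ColoredGraph d} (e : IsoData G H) (e' : IsoData G' H') :
    IsoData (G.disjUnion G') (H.disjUnion H') where
  white := Equiv.sumCongr e.white e'.white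
  black := Equiv.sumCongr e.black e'.black
  edge := by
    rintro c (x | x)
    · exact congrArg Sum.inl (e.edge c x)
    · exact congrArg Sum.inr (e'.edge c x)

def refl (G : ColoredGraph d) : IsoData G G := ⟨Equiv.refl _, Equiv.refl _, fun _ _ => rfl⟩

theorem linked (e : IsoData G H) (h : G.Linked) : H.Linked := by
  intro p q hpq x y
  have := h (p ∘ e.white) (q ∘ e.black) (fun c w => by
    simp only [Function.comp]; rw [hpq c, e.edge]) (e.white.symm x) (e.white.symm y)
  simpa using this

end IsoData

theorem Tight.iso {B B' : ColoredGraph d} {ω : ℕ} {ρ : B.White ≃ B.Black} (h : B.Tight ω ρ)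
    (e : IsoData B B') : B'.Tight ω (e.pairing ρ) where
  linked := e.linked h.linked
  cycles := by rw [e.totalCycles_pairing, h.cycles]
  lt τ hτ := by
    obtain ⟨τ, rfl⟩ := e.pairing.surjective τ
    rw [e.totalCycles_pairing]
    exact h.lt τ fun h0 => hτ (by rw [h0])
  cross A π w k hwk := by
    let E := (IsoData.refl A).disjUnion e
    have hEl : ∀ a, E.white (inlW a) = inlW a := fun _ => rfl
    have hEr : ∀ b, E.white (inrW b) = inrW (e.white b) := fun _ => rfl
    have hBl : ∀ a, E.black (inlB a) = inlB a := fun _ => rfl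
    have hBr : ∀ b, E.black (inrB b) = inrB (e.black b) := fun _ => rfl
    obtain ⟨π, rfl⟩ := E.pairing.surjective π
    have hwk' : π (inlW w) = inrB (e.black.symm k) := by
      apply E.black.injective
      rw [← E.pairing_apply, hEl, hwk, hBr, Equiv.apply_symm_apply]
    obtain ⟨π', a, b, hle, heq⟩ := h.cross A π _ _ hwk'
    rw [E.totalCycles_pairing]
    refine ⟨π', a, e.white b, hle, fun h0 => ?_⟩
    rw [heq h0]
    refine Equiv.ext fun x => ?_
    obtain ⟨x, rfl⟩ := E.white.surjective x
    rw [E.pairing_apply]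
    obtain ⟨x, rfl⟩ | ⟨x, rfl⟩ := white_cases x
    · rw [hEl]
      by_cases hx : x = a
      · rw [hx, glue_inl_self, glue_inl_self, e.pairing_apply, hBr]
      · rw [glue_inl _ _ _ _ hx, glue_inl _ _ _ _ hx, hBl]
    · rw [hEr]
      by_cases hx : x = b
      · rw [hx, glue_inr_self, glue_inr_self, hBl]
      · rw [glue_inr _ _ _ _ hx, glue_inr _ _ _ _ (by simpa using hx), e.pairing_apply, hBr]

/-- Each insertion adds `d - |C|` to `ω` and one white vertex, starting from `ω = d` and one white
vertex. The resulting identity is what identifies `scaling` with `d - ω`. -/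
theorem BuiltBy.exists_tight (hd : 0 < d) {B : ColoredGraph d} {S : Multiset (Finset (Fin d))}
    (hB : BuiltBy B S) (hS : ∀ C ∈ S, 2 * C.card < d) :
    ∃ ω ρ, B.Tight ω ρ ∧ ω + (S.map Finset.card).sum = d * (S.card + 1) ∧
      Fintype.card B.White = S.card + 1 := by
  induction hB with
  | two => exact ⟨d, (twoVertex d).edge ⟨0, hd⟩, tight_twoVertex _, by simp, rfl⟩
  | @white B S u C hC hB ih =>
    obtain ⟨ω, ρ, ht, hω, hc⟩ := ih fun C' h => hS C' (Multiset.mem_cons_of_mem h)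
    have hCd := hS C (Multiset.mem_cons_self _ _)
    have hC0 := hC.1.card_pos
    have hl := loops_insertAtWhite B u C
    have := ht.contraction hd (B.insertAtWhite_contraction u C) (by omega) (by omega)
    refine ⟨_, _, this, ?_, ?_⟩
    · rw [hl, Multiset.map_cons, Multiset.sum_cons, Multiset.card_cons, mul_add d (_ + 1), mul_one]
      omega
    · rw [Multiset.card_cons, ← hc]
      exact Fintype.card_option
  | @black B S u C hC hB ih =>
    obtain ⟨ω, ρ, ht, hω, hc⟩ := ih fun C' h => hS C' (Multiset.mem_cons_of_mem h)
    have hCd := hS C (Multiset.mem_cons_self _ _)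
    have hC0 := hC.1.card_pos
    have hl := loops_insertAtBlack B u C
    have := ht.contraction hd (B.insertAtBlack_contraction u C) (by omega) (by omega)
    refine ⟨_, _, this, ?_, ?_⟩
    · rw [hl, Multiset.map_cons, Multiset.sum_cons, Multiset.card_cons, mul_add d (_ + 1), mul_one]
      omega
    · rw [Multiset.card_cons, ← hc]
      exact Fintype.card_option
  | @iso B B' S e hB ih =>
    obtain ⟨ω, ρ, ht, hω, hc⟩ := ih hS
    obtain ⟨f, g, h⟩ := e
    exact ⟨ω, _, ht.iso ⟨f, g, h⟩, hω, (Fintype.card_congr f).symm.trans hc⟩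

theorem IsTotallyUnbalancedGM.exists_tight (hd : 0 < d) {B : ColoredGraph d}
    {S : Multiset (Finset (Fin d))} (h : B.IsTotallyUnbalancedGM S) :
    ∃ ω ρ, B.Tight ω ρ ∧ B.scaling S = d - ω ∧ 0 < Fintype.card B.White := by
  obtain ⟨ω, ρ, ht, hω, hc⟩ := h.1.exists_tight hd h.2
  refine ⟨ω, ρ, ht, ?_, by omega⟩
  have hV : B.numVertices = 2 * (S.card + 1) := by
    unfold numVertices
    rw [← card_white_eq_card_black hd B, hc]
    ring
  unfold scaling
  rw [hV]
  have h2 : ((d : ℤ) * (((2 * (S.card + 1) : ℕ) : ℤ) - 2)) / 2 = d * S.card := by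
    push_cast
    rw [show (d : ℤ) * (2 * ((S.card : ℤ) + 1) - 2) = (d * S.card) * 2 by ring,
      Int.mul_ediv_cancel _ (by norm_num)]
  rw [h2]
  have : (ω : ℤ) + ((S.map Finset.card).sum : ℕ) = d * (S.card + 1) := by exact_mod_cast hω
  linarith

end ColoredGraph

namespace ColoredGraph

variable {d : ℕ}

open Equiv Equiv.Perm

/-! ### Disjoint unions of families -/

/-- The disjoint union of a family. -/
def famUnion {ι : Type} [Fintype ι] [DecidableEq ι] (F : ι → ColoredGraph d) : ColoredGraph d where
  White := Σ i, (F i).White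
  Black := Σ i, (F i).Black
  edge := fun c => Equiv.sigmaCongrRight fun i => (F i).edge c

section famUnion

variable {ι : Type} [Fintype ι] [DecidableEq ι] {F : ι → ColoredGraph d}

def famW (i : ι) (x : (F i).White) : (famUnion F).White := ⟨i, x⟩
def famB (i : ι) (x : (F i).Black) : (famUnion F).Black := ⟨i, x⟩

theorem famW_cases (x : (famUnion F).White) : ∃ i y, x = famW i y := ⟨x.1, x.2, rfl⟩
theorem famB_cases (x : (famUnion F).Black) : ∃ i y, x = famB i y := ⟨x.1, x.2, rfl⟩

@[simp] theorem famUnion_edge (c : Fin d) (i : ι) (x : (F i).White) :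
    (famUnion F).edge c (famW i x) = famB i ((F i).edge c x) := rfl

/-- Separating one summand of a sigma type. -/
noncomputable def peelEquiv (X : Type) (Y : ι → Type) (i₀ : ι) :
    (X ⊕ Y i₀) ⊕ (Σ i : {i // i ≠ i₀}, Y i) ≃ X ⊕ Σ i, Y i :=
  Equiv.ofBijective
    (Sum.elim (Sum.elim (fun a => Sum.inl a) fun x => Sum.inr ⟨i₀, x⟩)
      fun z => Sum.inr ⟨z.1, z.2⟩) (by
    constructor
    · rintro ((a | x) | ⟨⟨i, hi⟩, x⟩) ((a' | x') | ⟨⟨i', hi'⟩, x'⟩) h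
      · simpa using h
      · simp at h
      · simp at h
      · simp at h
      · simpa using h
      · simp only [Sum.elim_inl, Sum.elim_inr, Sum.inr.injEq, Sigma.mk.injEq] at h
        exact absurd h.1.symm hi'
      · simp at h
      · simp only [Sum.elim_inl, Sum.elim_inr, Sum.inr.injEq, Sigma.mk.injEq] at h
        exact absurd h.1 hi
      · simp only [Sum.elim_inr, Sum.inr.injEq, Sigma.mk.injEq] at h
        obtain ⟨rfl, h⟩ := h
        rw [eq_of_heq h]
    · rintro (a | ⟨i, x⟩)
      · exact ⟨Sum.inl (Sum.inl a), rfl⟩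
      · by_cases h : i = i₀
        · subst h; exact ⟨Sum.inl (Sum.inr x), rfl⟩
        · exact ⟨Sum.inr ⟨⟨i, h⟩, x⟩, rfl⟩)

/-- Separating one member of a family. -/
noncomputable def peel (A : ColoredGraph d) (F : ι → ColoredGraph d) (i₀ : ι) : IsoData
    ((A.disjUnion (F i₀)).disjUnion (famUnion fun i : {i // i ≠ i₀} => F i))
    (A.disjUnion (famUnion F)) where
  white := peelEquiv A.White (fun i => (F i).White) i₀
  black := peelEquiv A.Black (fun i => (F i).Black) i₀
  edge := by rintro c ((a | x) | ⟨⟨i, hi⟩, x⟩) <;> rfl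

section peel

variable {A : ColoredGraph d} {i₀ : ι}

theorem peel_white_inl_inl (a : A.White) : (peel A F i₀).white (inlW (inlW a)) = inlW a := rfl
theorem peel_white_inl_inr (x : (F i₀).White) :
    (peel A F i₀).white (inlW (inrW x)) = inrW (famW i₀ x) := rfl
theorem peel_white_inr (i : {i // i ≠ i₀}) (x : (F i).White) :
    (peel A F i₀).white (inrW (famW i x)) = inrW (famW (F := F) i x) := rfl
theorem peel_black_inl_inl (a : A.Black) : (peel A F i₀).black (inlB (inlB a)) = inlB a := rfl
theorem peel_black_inl_inr (x : (F i₀).Black) :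
    (peel A F i₀).black (inlB (inrB x)) = inrB (famB i₀ x) := rfl
theorem peel_black_inr (i : {i // i ≠ i₀}) (x : (F i).Black) :
    (peel A F i₀).black (inrB (famB i x)) = inrB (famB (F := F) i x) := rfl

end peel

theorem totalCycles_of_isEmpty {G : ColoredGraph d} [IsEmpty G.White] (π : G.White ≃ G.Black) :
    G.totalCycles π = 0 := by
  unfold totalCycles
  refine Finset.sum_eq_zero fun c _ => ?_
  rw [bicoloredCycles_eq, numCycles]
  have : IsEmpty (Quotient (SameCycle.setoid ((G.edge c).trans π.symm))) :=
    ⟨fun q => q.inductionOn fun x => isEmptyElim x⟩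
  exact Nat.card_of_isEmpty

theorem isEmpty_famUnion_white [IsEmpty ι] : IsEmpty (famUnion F).White :=
  ⟨fun x => isEmptyElim x.1⟩
theorem isEmpty_famUnion_black [IsEmpty ι] : IsEmpty (famUnion F).Black :=
  ⟨fun x => isEmptyElim x.1⟩

end famUnion

/-! ### The structure of dominant graphs -/

/-- The vertices of `A ⊔ Γ` can be labelled by the pairs of `ρ` in such a way that the labels are
constant along the edges, except the colored edges of `A`. -/
def Labelled (A Γ : ColoredGraph d) (π : (A.disjUnion Γ).White ≃ (A.disjUnion Γ).Black)
    (ρ : A.White ≃ A.Black) : Prop :=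
  ∃ (f : (A.disjUnion Γ).White → A.White) (g : (A.disjUnion Γ).Black → A.White),
    (∀ a, f (inlW a) = a) ∧ (∀ b, g (inlB b) = ρ.symm b) ∧
    (∀ c x, g (inrB (Γ.edge c x)) = f (inrW x)) ∧ ∀ x, g (π x) = f x

/-- No non-empty set of members of the family is separated from the rest of the graph. -/
def Attached {A : ColoredGraph d} {ι : Type} [Fintype ι] [DecidableEq ι] {F : ι → ColoredGraph d}
    (π : (A.disjUnion (famUnion F)).White ≃ (A.disjUnion (famUnion F)).Black) : Prop :=
  ∀ J : Set ι, J.Nonempty → ∃ i ∈ J, ∃ x : (F i).White, ∀ j ∈ J, ∀ y : (F j).Black,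
    π (inrW (famW i x)) ≠ inrB (famB j y)

theorem Attached.exists_cross (hd : 0 < d) {A : ColoredGraph d} {ι : Type} [Fintype ι]
    [DecidableEq ι] [Nonempty ι] {F : ι → ColoredGraph d}
    {π : (A.disjUnion (famUnion F)).White ≃ (A.disjUnion (famUnion F)).Black}
    (h : Attached π) : ∃ w i k, π (inlW w) = inrB (famB i k) := by
  obtain ⟨i, -, x, hx⟩ := h Set.univ Set.univ_nonempty
  by_contra hne
  obtain ⟨y, hy⟩ := exists_inrW_of_inlW hd (π := π) (fun w => by
    obtain ⟨b, hb⟩ | ⟨b, hb⟩ := black_cases (π (inlW w))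
    · exact ⟨b, hb⟩
    · obtain ⟨i, k, rfl⟩ := famB_cases b
      exact absurd ⟨w, i, k, hb⟩ hne) (famW i x)
  obtain ⟨j, y, rfl⟩ := famB_cases y
  exact hx j (Set.mem_univ _) y hy

theorem labelled_glue {A B : ColoredGraph d} (π : A.White ≃ A.Black) (ρ : B.White ≃ B.Black)
    (a : A.White) (b : B.White) (t : (A.disjUnion B).White) :
    (Sum.elim π.symm (fun _ => a) : A.Black ⊕ B.Black → A.White) (glue π ρ a b t) =
      (Sum.elim id (fun _ => a) : A.White ⊕ B.White → A.White) t := by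
  obtain ⟨x, rfl⟩ | ⟨x, rfl⟩ := white_cases t
  · by_cases hx : x = a
    · rw [hx, glue_inl_self]; rfl
    · rw [glue_inl _ _ _ _ hx]; exact π.symm_apply_apply x
  · by_cases hx : x = b
    · rw [hx, glue_inr_self]; exact π.symm_apply_apply a
    · rw [glue_inr _ _ _ _ hx]; rfl

/-- Induction on the number of bubbles: along an edge of color 0 leaving `A`, a bubble is merged
into `A` by contraction, and the result takes the role of `A` for the remaining ones. The label of a
vertex records the pair of `σ` on which its bubble hangs. -/
theorem exists_labelled (hd : 0 < d) (n : ℕ) : ∀ {ι : Type} [Fintype ι] [DecidableEq ι]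
    (_ : Fintype.card ι = n) {F : ι → ColoredGraph d} {ω : ι → ℕ}
    {ρ : ∀ i, (F i).White ≃ (F i).Black} (_ : ∀ i, (F i).Tight (ω i) (ρ i)) {A : ColoredGraph d}
    {π : (A.disjUnion (famUnion F)).White ≃ (A.disjUnion (famUnion F)).Black} (_ : Attached π),
    ∃ σ : A.White ≃ A.Black,
      (A.disjUnion (famUnion F)).totalCycles π + d * n ≤ A.totalCycles σ + ∑ i, ω i ∧
      ((A.disjUnion (famUnion F)).totalCycles π + d * n = A.totalCycles σ + ∑ i, ω i →
        Labelled A (famUnion F) π σ) := by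
  induction n with
  | zero =>
    intro ι _ _ hn F ω ρ hT A π hπ
    have : IsEmpty ι := Fintype.card_eq_zero_iff.1 hn
    have hW : IsEmpty (famUnion F).White := isEmpty_famUnion_white
    have hB : IsEmpty (famUnion F).Black := isEmpty_famUnion_black
    obtain ⟨π₁, π₂, rfl⟩ := exists_eq_sumPairing_of_not_cross hd (π := π)
      fun ⟨_, k, _⟩ => isEmptyElim k
    refine ⟨π₁, ?_, fun _ => ?_⟩
    · rw [totalCycles_sumPairing, totalCycles_of_isEmpty π₂]
      simp
    · refine ⟨(Sum.elim id isEmptyElim : A.White ⊕ (famUnion F).White → A.White),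
        (Sum.elim π₁.symm isEmptyElim : A.Black ⊕ (famUnion F).Black → A.White),
        fun _ => rfl, fun _ => rfl, fun _ x => isEmptyElim x, fun x => ?_⟩
      obtain ⟨x, rfl⟩ | ⟨x, rfl⟩ := white_cases x
      · exact π₁.symm_apply_apply x
      · exact isEmptyElim x
  | succ n ih =>
    intro ι _ _ hn F ω ρ hT A π hπ
    have : Nonempty ι := Fintype.card_pos_iff.1 (by omega)
    obtain ⟨w, i₀, k, hwk⟩ := hπ.exists_cross hd
    set e := peel A F i₀ with he
    obtain ⟨π₁, rfl⟩ := e.pairing.surjective π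
    have hwk₁ : π₁ (inlW (inlW w)) = inlB (inrB k) := by
      apply e.black.injective
      rw [← e.pairing_apply, he, peel_white_inl_inl, hwk, peel_black_inl_inr]
    -- No colored edge joins `A` to `F i₀`, so contracting `w` with `k` loses no cycle.
    obtain ⟨A', ⟨κ⟩⟩ := exists_contraction (A.disjUnion (F i₀)) (inlW w) (inrB k)
    let K := κ.inl (famUnion fun i : {i // i ≠ i₀} => F i)
    obtain ⟨π₂, rfl⟩ := K.exists_extend_eq hwk₁
    have hKl : ∀ x, K.white (some (inlW x)) = inlW (κ.white (some x)) := fun _ => rfl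
    have hKr : ∀ x, K.white (some (inrW x)) = inrW x := fun _ => rfl
    have hKbl : ∀ x, K.black (some (inlB x)) = inlB (κ.black (some x)) := fun _ => rfl
    have hKbr : ∀ x, K.black (some (inrB x)) = inrB x := fun _ => rfl
    have hatt : Attached π₂ := by
      intro J hJ
      obtain ⟨_, ⟨i, hi, rfl⟩, x, hx⟩ := hπ (Subtype.val '' J) (hJ.image _)
      refine ⟨i, hi, x, fun j hj y h => hx j ⟨j, hj, rfl⟩ y ?_⟩
      rw [← peel_white_inr i x, ← he, e.pairing_apply, ← hKr, K.extend_white_some, h, hKbr, he,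
        peel_black_inr]
    have hcard : Fintype.card {i // i ≠ i₀} = n := by
      rw [Fintype.card_subtype_compl, Fintype.card_subtype_eq, hn]; rfl
    obtain ⟨σ₂, hle₂, heq₂⟩ := ih hcard (fun i => hT i) hatt
    -- Undoing the contraction in `σ₂` pairs `w` with `k`, hence gives a crossing pairing of `A ⊔ F
    -- i₀`, to which tightness applies.
    obtain ⟨σ, a, b, hle, heq⟩ := (hT i₀).cross A (κ.extend σ₂) w k (κ.extend_apply σ₂)
    have hsum : ∑ i, ω i = ω i₀ + ∑ i : {i // i ≠ i₀}, ω i :=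
      Fintype.sum_eq_add_sum_subtype_ne _ _
    rw [κ.totalCycles_extend, loops_disjUnion_inl_inr, add_zero] at hle heq
    rw [e.totalCycles_pairing, K.totalCycles_extend, loops_disjUnion_inl, loops_disjUnion_inl_inr,
      add_zero, hsum, mul_add, mul_one]
    refine ⟨σ, by omega, fun h => ?_⟩
    -- Equality in the sum of two inequalities forces equality in each.
    have hglue := heq (by omega)
    obtain ⟨f₂, g₂, hf₂, hg₂, hfg₂, hπ₂⟩ := heq₂ (by omega)
    have haw : a = w := by
      by_contra hne
      have := DFunLike.congr_fun hglue (inlW w)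
      rw [κ.extend_apply, glue_inl _ _ _ _ (Ne.symm hne)] at this
      exact inrB_ne_inlB this
    subst haw
    -- All of `F i₀` gets the label `a`, the vertex at which it was glued. Labels in `A'` given by
    -- the induction are pushed to labels in `A` by `g`.
    let G : (A.disjUnion (F i₀)).White → A.White :=
      (Sum.elim id (fun _ => a) : A.White ⊕ (F i₀).White → A.White)
    let H : (A.disjUnion (F i₀)).Black → A.White :=
      (Sum.elim σ.symm (fun _ => a) : A.Black ⊕ (F i₀).Black → A.White)
    have hHG : ∀ t, H (κ.extend σ₂ t) = G t := fun t => by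
      rw [hglue]; exact labelled_glue σ (ρ i₀) a b t
    let g : A'.White → A.White := fun z => G (κ.white (some z))
    let fW : ((A.disjUnion (F i₀)).disjUnion (famUnion fun i : {i // i ≠ i₀} => F i)).White →
        A.White := fun x => Sum.elim G (fun z => g (f₂ (inrW z))) x
    let fB : ((A.disjUnion (F i₀)).disjUnion (famUnion fun i : {i // i ≠ i₀} => F i)).Black →
        A.White := fun x => Sum.elim H (fun z => g (g₂ (inrB z))) x
    have hfW : ∀ z, fW (K.white (some z)) = g (f₂ z) := by
      intro z
      obtain ⟨z, rfl⟩ | ⟨z, rfl⟩ := white_cases z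
      · rw [hf₂]; rfl
      · rfl
    have hfB : ∀ z, fB (K.black (some z)) = g (g₂ z) := by
      intro z
      obtain ⟨z, rfl⟩ | ⟨z, rfl⟩ := black_cases z
      · rw [hg₂, hKbl]
        change H _ = G _
        rw [← hHG, κ.extend_white_some, Equiv.apply_symm_apply]
      · rfl
    refine ⟨fun x => fW (e.white.symm x), fun x => fB (e.black.symm x), fun x => ?_, fun x => ?_,
      fun c x => ?_, fun x => ?_⟩ <;> beta_reduce
    · rw [← peel_white_inl_inl (F := F) (i₀ := i₀), ← he, Equiv.symm_apply_apply]; rfl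
    · rw [← peel_black_inl_inl (F := F) (i₀ := i₀), ← he, Equiv.symm_apply_apply]; rfl
    · obtain ⟨i, x, rfl⟩ := famW_cases x
      rw [famUnion_edge]
      by_cases hi : i = i₀
      · subst hi
        rw [← peel_white_inl_inr (A := A), ← peel_black_inl_inr (A := A), ← he,
          Equiv.symm_apply_apply, Equiv.symm_apply_apply]
        rfl
      · rw [← peel_white_inr (A := A) ⟨i, hi⟩, ← peel_black_inr (A := A) ⟨i, hi⟩, ← he,
          Equiv.symm_apply_apply, Equiv.symm_apply_apply]
        exact congrArg g (hfg₂ c (famW (F := fun i : {i // i ≠ i₀} => F i) ⟨i, hi⟩ x))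
    · obtain ⟨x, rfl⟩ := e.white.surjective x
      rw [e.pairing_apply, Equiv.symm_apply_apply, Equiv.symm_apply_apply]
      obtain ⟨x, rfl⟩ := K.white.surjective x
      cases x with
      | none => rw [K.white_none, K.extend_apply]; rfl
      | some x => rw [K.extend_white_some, hfW, hfB, hπ₂]

/-! ### Connectedness -/

/-- Every set of vertices closed under all edges is empty or everything. -/
def FeynmanLinked (G : ColoredGraph d) (π : G.White ≃ G.Black) : Prop :=
  ∀ (p : G.White → Prop) (q : G.Black → Prop), (∀ c w, p w ↔ q (G.edge c w)) →
    (∀ w, p w ↔ q (π w)) → ∀ x y, p x ↔ p y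

theorem FeynmanLinked.iso {G H : ColoredGraph d} (e : IsoData G H) {π : G.White ≃ G.Black}
    (h : G.FeynmanLinked π) : H.FeynmanLinked (e.pairing π) := by
  intro p q hpq hπ x y
  have := h (p ∘ e.white) (q ∘ e.black) (fun c w => by
    simp only [Function.comp]; rw [hpq c, e.edge]) (fun w => by
    simp only [Function.comp]; rw [hπ, e.pairing_apply]) (e.white.symm x) (e.white.symm y)
  simpa using this

theorem FeynmanLinked.glue {A B : ColoredGraph d} {π : A.White ≃ A.Black} (h : A.FeynmanLinked π)
    (hB : B.Linked) (ρ : B.White ≃ B.Black) (hd : 0 < d) (a : A.White) (b : B.White) :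
    (A.disjUnion B).FeynmanLinked (glue π ρ a b) := by
  intro p q hpq hπ
  have hBc := hB (fun x => p (inrW x)) (fun x => q (inrB x)) fun c x => hpq c (inrW x)
  have h1 : p (inlW a) ↔ p (inrW b) := by
    rw [hπ (inlW a), glue_inl_self, ← (B.edge ⟨0, hd⟩).apply_symm_apply (ρ b),
      ← disjUnion_edge_inrW, ← hpq]
    exact hBc _ _
  have hAc := h (fun x => p (inlW x)) (fun x => q (inlB x)) (fun c x => hpq c (inlW x)) fun x => by
    by_cases hx : x = a
    · rw [hx, h1, hπ, glue_inr_self]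
    · rw [hπ, glue_inl _ _ _ _ hx]
  have : ∀ x, p x ↔ p (inlW a) := by
    intro x
    obtain ⟨x, rfl⟩ | ⟨x, rfl⟩ := white_cases x
    · exact hAc x a
    · rw [h1]; exact hBc x b
  intro x y
  rw [this x, this y]

/-- The bound of `exists_labelled` is attained for every starting pairing `σ`: each `glue` keeps the
graph connected and changes the cycle count by exactly `ω i - d`. -/
theorem exists_feynmanLinked (hd : 0 < d) (n : ℕ) : ∀ {ι : Type} [Fintype ι] [DecidableEq ι]
    (_ : Fintype.card ι = n) {F : ι → ColoredGraph d} {ω : ι → ℕ}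
    {ρ : ∀ i, (F i).White ≃ (F i).Black} (_ : ∀ i, (F i).Tight (ω i) (ρ i))
    (_ : ∀ i, Nonempty (F i).White) {A : ColoredGraph d} (_ : Nonempty A.White)
    {σ : A.White ≃ A.Black} (_ : A.FeynmanLinked σ),
    ∃ π, (A.disjUnion (famUnion F)).FeynmanLinked π ∧
      (A.disjUnion (famUnion F)).totalCycles π + d * n = A.totalCycles σ + ∑ i, ω i := by
  induction n with
  | zero =>
    intro ι _ _ hn F ω ρ hT hF A hA σ hσ
    have : IsEmpty ι := Fintype.card_eq_zero_iff.1 hn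
    have hW : IsEmpty (famUnion F).White := isEmpty_famUnion_white
    have hB : IsEmpty (famUnion F).Black := isEmpty_famUnion_black
    refine ⟨sumPairing σ (Equiv.equivOfIsEmpty _ _), fun p q hpq hπ x y => ?_, ?_⟩
    · obtain ⟨x, rfl⟩ | ⟨x, rfl⟩ := white_cases x
      · obtain ⟨y, rfl⟩ | ⟨y, rfl⟩ := white_cases y
        · exact hσ (fun x => p (inlW x)) (fun x => q (inlB x)) (fun c x => hpq c (inlW x))
            (fun x => hπ (inlW x)) x y
        · exact isEmptyElim y
      · exact isEmptyElim x
    · rw [totalCycles_sumPairing, totalCycles_of_isEmpty (Equiv.equivOfIsEmpty _ _)]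
      simp
  | succ n ih =>
    intro ι _ _ hn F ω ρ hT hF A hA σ hσ
    obtain ⟨i₀⟩ : Nonempty ι := Fintype.card_pos_iff.1 (by omega)
    obtain ⟨a⟩ := hA
    obtain ⟨b⟩ := hF i₀
    have hcard : Fintype.card {i // i ≠ i₀} = n := by
      rw [Fintype.card_subtype_compl, Fintype.card_subtype_eq, hn]; rfl
    have hsum : ∑ i, ω i = ω i₀ + ∑ i : {i // i ≠ i₀}, ω i :=
      Fintype.sum_eq_add_sum_subtype_ne _ _
    obtain ⟨π, hπ, ht⟩ := ih hcard (F := fun i : {i // i ≠ i₀} => F i) (ω := fun i => ω i)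
      (ρ := fun i => ρ i) (fun i => hT i) (fun i => hF i) (A := A.disjUnion (F i₀)) ⟨inlW a⟩
      (hσ.glue (hT i₀).linked (ρ i₀) hd a b)
    refine ⟨(peel A F i₀).pairing π, hπ.iso _, ?_⟩
    have hg := totalCycles_glue σ (ρ i₀) a b
    rw [(hT i₀).cycles] at hg
    rw [IsoData.totalCycles_pairing, hsum, mul_add, mul_one]
    omega

/-- Reduces connectedness to predicates invariant along edges, which are easy to transport through
contractions and to refute by a cut. -/
theorem connected_iff_forall {V : Type} (H : SimpleGraph V) : H.Connected ↔
    Nonempty V ∧ ∀ P : V → Prop, (∀ x y, H.Adj x y → (P x ↔ P y)) → ∀ x y, P x ↔ P y := by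
  constructor
  · intro h
    refine ⟨h.nonempty, fun P hP x y => ?_⟩
    obtain ⟨p⟩ := h.preconnected x y
    induction p with
    | nil => rfl
    | cons hadj _ ih => rw [hP _ _ hadj, ih]
  · rintro ⟨hne, h⟩
    refine ⟨fun x y => ?_⟩
    exact (h (fun z => H.Reachable x z) (fun y z hyz =>
      ⟨fun hr => hr.trans hyz.reachable, fun hr => hr.trans hyz.symm.reachable⟩) x y).1
        (SimpleGraph.Reachable.refl x)

theorem skeleton_forall_iff (G : ColoredGraph d) (P : G.White ⊕ G.Black → Prop) :
    (∀ x y, G.skeleton.Adj x y → (P x ↔ P y)) ↔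
      ∀ c w, P (Sum.inl w) ↔ P (Sum.inr (G.edge c w)) := by
  unfold skeleton
  constructor
  · intro h c w
    exact h _ _ ((SimpleGraph.fromRel_adj _ _ _).2 ⟨by simp, Or.inl ⟨c, w, rfl, rfl⟩⟩)
  · intro h x y hxy
    obtain ⟨-, ⟨c, w, rfl, rfl⟩ | ⟨c, w, rfl, rfl⟩⟩ := (SimpleGraph.fromRel_adj _ _ _).1 hxy
    · exact h c w
    · exact (h c w).symm

theorem wickEdges_forall_iff (G : ColoredGraph d) (π : G.White ≃ G.Black) (D : Set G.White)
    (P : G.White ⊕ G.Black → Prop) :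
    (∀ x y, (G.wickEdges π D).Adj x y → (P x ↔ P y)) ↔
      ∀ w ∉ D, P (Sum.inl w) ↔ P (Sum.inr (π w)) := by
  unfold wickEdges
  constructor
  · intro h w hw
    exact h _ _ ((SimpleGraph.fromRel_adj _ _ _).2 ⟨by simp, Or.inl ⟨w, hw, rfl, rfl⟩⟩)
  · intro h x y hxy
    obtain ⟨-, ⟨w, hw, rfl, rfl⟩ | ⟨w, hw, rfl, rfl⟩⟩ := (SimpleGraph.fromRel_adj _ _ _).1 hxy
    · exact h w hw
    · exact (h w hw).symm

theorem nonempty_white (hd : 0 < d) {G : ColoredGraph d} (h : Nonempty (G.White ⊕ G.Black)) :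
    Nonempty G.White := by
  obtain ⟨x | x⟩ := h
  · exact ⟨x⟩
  · exact ⟨(G.edge ⟨0, hd⟩).symm x⟩

theorem IsBubble.linked {G : ColoredGraph d} (h : G.IsBubble) : G.Linked := by
  intro p q hpq x y
  exact ((connected_iff_forall _).1 h).2 (Sum.elim p q) ((skeleton_forall_iff _ _).2 hpq)
    (Sum.inl x) (Sum.inl y)

theorem mem_feynmanGraphs (hd : 0 < d) {G : ColoredGraph d} {π : G.White ≃ G.Black} :
    π ∈ G.feynmanGraphs ↔ Nonempty G.White ∧ G.FeynmanLinked π := by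
  unfold feynmanGraphs
  rw [Set.mem_ofPred_eq, connected_iff_forall]
  have hsup : ∀ P : G.White ⊕ G.Black → Prop,
      (∀ x y, (G.skeleton ⊔ G.wickEdges π ∅).Adj x y → (P x ↔ P y)) ↔
        (∀ c w, P (Sum.inl w) ↔ P (Sum.inr (G.edge c w))) ∧
          ∀ w, P (Sum.inl w) ↔ P (Sum.inr (π w)) := by
    intro P
    rw [← skeleton_forall_iff]
    have := wickEdges_forall_iff G π ∅ P
    simp only [Set.mem_empty_iff_false, not_false_eq_true, forall_const] at this
    rw [← this]
    simp only [SimpleGraph.sup_adj]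
    exact ⟨fun h => ⟨fun x y hxy => h x y (Or.inl hxy), fun x y hxy => h x y (Or.inr hxy)⟩,
      fun h x y hxy => hxy.elim (h.1 x y) (h.2 x y)⟩
  constructor
  · rintro ⟨hne, h⟩
    exact ⟨nonempty_white hd hne, fun p q hpq hπ x y =>
      h (Sum.elim p q) ((hsup _).2 ⟨hpq, hπ⟩) (Sum.inl x) (Sum.inl y)⟩
  · rintro ⟨⟨w⟩, h⟩
    refine ⟨⟨Sum.inl w⟩, fun P hP => ?_⟩
    obtain ⟨h1, h2⟩ := (hsup P).1 hP
    have h3 := h (fun x => P (Sum.inl x)) (fun y => P (Sum.inr y)) h1 h2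
    have : ∀ x, P x ↔ P (Sum.inl w) := by
      rintro (x | x)
      · exact h3 x w
      · have := h1 ⟨0, hd⟩ ((G.edge ⟨0, hd⟩).symm x)
        rw [Equiv.apply_symm_apply] at this
        rw [← this]
        exact h3 _ w
    intro x y
    rw [this x, this y]

theorem IsBubble.mem_feynmanGraphs (hd : 0 < d) {A : ColoredGraph d} (h : A.IsBubble)
    (π : A.White ≃ A.Black) : π ∈ A.feynmanGraphs :=
  (ColoredGraph.mem_feynmanGraphs hd).2
    ⟨nonempty_white hd h.nonempty, fun p q hpq _ => h.linked p q hpq⟩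

/-- If all edges of color 0 from white vertices in `J` ended in `J`, finiteness would make them
cover all black vertices of `J`. Then `J` would be separated from `A`. -/
theorem FeynmanLinked.attached (hd : 0 < d) {A : ColoredGraph d} {ι : Type} [Fintype ι]
    [DecidableEq ι] {F : ι → ColoredGraph d} (hA : Nonempty A.White)
    (hF : ∀ i, Nonempty (F i).White)
    {π : (A.disjUnion (famUnion F)).White ≃ (A.disjUnion (famUnion F)).Black}
    (h : FeynmanLinked _ π) : Attached π := by
  rintro J ⟨i₀, hi₀⟩
  by_contra! hne
  obtain ⟨a⟩ := hA
  obtain ⟨b⟩ := hF i₀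
  let p : (A.disjUnion (famUnion F)).White → Prop :=
    (Sum.elim (fun _ => False) (fun z => z.1 ∈ J) : A.White ⊕ (Σ i, (F i).White) → Prop)
  let q : (A.disjUnion (famUnion F)).Black → Prop :=
    (Sum.elim (fun _ => False) (fun z => z.1 ∈ J) : A.Black ⊕ (Σ i, (F i).Black) → Prop)
  have hpq : ∀ c w, p w ↔ q ((A.disjUnion (famUnion F)).edge c w) := by
    intro c w
    obtain ⟨w, rfl⟩ | ⟨w, rfl⟩ := white_cases w <;> rfl
  have hmaps : ∀ w, p w → q (π w) := by
    intro w hw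
    obtain ⟨w, rfl⟩ | ⟨w, rfl⟩ := white_cases w
    · exact absurd hw id
    · obtain ⟨i, x, rfl⟩ := famW_cases w
      obtain ⟨j, hj, y, hy⟩ := hne i hw x
      rw [hy]
      exact hj
  -- Following a fixed color back to white vertices turns `π` into a permutation, and an injective
  -- map of a finite set into itself is onto.
  let τ : Perm (A.disjUnion (famUnion F)).White :=
    π.trans ((A.disjUnion (famUnion F)).edge ⟨0, hd⟩).symm
  have hτ : ∀ w, q (π w) ↔ p (τ w) := fun w => by
    rw [hpq ⟨0, hd⟩ (τ w)]; simp [τ]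
  have hinv : ∀ w, p w ↔ q (π w) := by
    intro w
    refine ⟨hmaps w, fun hw => ?_⟩
    have hsub : τ '' {x | p x} ⊆ {x | p x} := by
      rintro _ ⟨x, hx, rfl⟩
      exact (hτ x).1 (hmaps x hx)
    have heq := Set.eq_of_subset_of_ncard_le hsub
      (Set.ncard_image_of_injective _ τ.injective).ge (Set.toFinite _)
    obtain ⟨x, hx, hxw⟩ := heq.ge ((hτ w).1 hw)
    exact τ.injective hxw ▸ hx
  exact ((h p q hpq hinv (inlW a) (inrW (famW i₀ b))).2 hi₀)

/-- The vertices of `Γ` labelled `v` touch the rest of the graph only through the edges of color 0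
at `v` and `ρ v`. If these are not one edge, the set contains `π v`, so deleting both edges
disconnects it from `v`. -/
theorem Labelled.maximalTwoCut {A Γ : ColoredGraph d}
    {π : (A.disjUnion Γ).White ≃ (A.disjUnion Γ).Black} {ρ : A.White ≃ A.Black}
    (h : Labelled A Γ π ρ) (hρ : ρ ∈ A.dominantGraphs) : MaximalTwoCut A Γ π := by
  obtain ⟨f, g, hf, hg, hfg, hπ⟩ := h
  refine ⟨ρ, hρ, fun v => ?_⟩
  by_cases hv : π (inlW v) = inlB (ρ v)
  · exact Or.inl hv
  right
  intro hconn
  obtain ⟨y, hy⟩ : ∃ y, π (inlW v) = inrB y := by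
    obtain ⟨b, hb⟩ | ⟨y, hy⟩ := black_cases (π (inlW v))
    · have := hπ (inlW v)
      rw [hb, hg, hf, Equiv.symm_apply_eq] at this
      exact absurd (by rw [hb, this]) hv
    · exact ⟨y, hy⟩
  let p : (A.disjUnion Γ).White → Prop :=
    (Sum.elim (fun _ => False) (fun z => f (inrW z) = v) : A.White ⊕ Γ.White → Prop)
  let q : (A.disjUnion Γ).Black → Prop :=
    (Sum.elim (fun _ => False) (fun z => g (inrB z) = v) : A.Black ⊕ Γ.Black → Prop)
  have h1 : ∀ c w, p w ↔ q ((A.disjUnion Γ).edge c w) := by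
    intro c w
    obtain ⟨w, rfl⟩ | ⟨w, rfl⟩ := white_cases w
    · rfl
    · change f (inrW w) = v ↔ g (inrB (Γ.edge c w)) = v
      rw [hfg]
  have h2 : ∀ w ∉ ({inlW v, π.symm (inlB (ρ v))} : Set (A.disjUnion Γ).White),
      p w ↔ q (π w) := by
    intro w hw
    simp only [Set.mem_insert_iff, Set.mem_singleton_iff, not_or, Equiv.eq_symm_apply] at hw
    have hw0 := hπ w
    have hp : p w ↔ f w = v := by
      obtain ⟨x, rfl⟩ | ⟨x, rfl⟩ := white_cases w
      · rw [hf]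
        exact ⟨fun h => absurd h id, fun h => absurd (by rw [h]) hw.1⟩
      · rfl
    have hq : q (π w) ↔ g (π w) = v := by
      obtain ⟨x, hx⟩ | ⟨x, hx⟩ := black_cases (π w)
      · rw [hx] at hw ⊢
        rw [hg, Equiv.symm_apply_eq]
        exact ⟨fun h => absurd h id, fun h => absurd (by rw [h]) hw.2⟩
      · rw [hx]; rfl
    rw [hp, hq, hw0]
  have hall := ((connected_iff_forall _).1 hconn).2 (Sum.elim p q) (fun x y hxy => by
    rw [SimpleGraph.sup_adj] at hxy
    rcases hxy with hxy | hxy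
    · exact (skeleton_forall_iff _ (Sum.elim p q)).2 h1 x y hxy
    · exact (wickEdges_forall_iff _ _ _ (Sum.elim p q)).2 h2 x y hxy)
    (Sum.inl (inlW v)) (Sum.inr (inrB y))
  refine hall.2 ?_
  have := hπ (inlW v)
  rw [hy, hf] at this
  exact this

theorem Labelled.iso {A Γ Γ' : ColoredGraph d} (e : IsoData Γ Γ')
    {π : (A.disjUnion Γ).White ≃ (A.disjUnion Γ).Black} {ρ : A.White ≃ A.Black}
    (h : Labelled A Γ π ρ) :
    Labelled A Γ' (((IsoData.refl A).disjUnion e).pairing π) ρ := by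
  obtain ⟨f, g, hf, hg, hfg, hπ⟩ := h
  set E := (IsoData.refl A).disjUnion e
  have hl : ∀ a, E.white.symm (inlW a) = inlW a := fun _ => rfl
  have hr : ∀ x, E.white.symm (inrW x) = inrW (e.white.symm x) := fun _ => rfl
  have hbl : ∀ a, E.black.symm (inlB a) = inlB a := fun _ => rfl
  have hbr : ∀ x, E.black.symm (inrB x) = inrB (e.black.symm x) := fun _ => rfl
  refine ⟨fun x => f (E.white.symm x), fun x => g (E.black.symm x), fun a => ?_, fun b => ?_,
    fun c x => ?_, fun x => ?_⟩
  · beta_reduce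
    rw [hl, hf]
  · beta_reduce
    rw [hbl, hg]
  · obtain ⟨x, rfl⟩ := e.white.surjective x
    beta_reduce
    rw [hr, hbr, e.edge, Equiv.symm_apply_apply, Equiv.symm_apply_apply, hfg]
  · obtain ⟨x, rfl⟩ := E.white.surjective x
    beta_reduce
    rw [E.pairing_apply, Equiv.symm_apply_apply, Equiv.symm_apply_apply, hπ]

/-- The copies of the bubbles `B r` as a family. -/
def copiesIso {R : Type} [Fintype R] [DecidableEq R] (B : R → ColoredGraph d) (b : R → ℕ) :
    IsoData (famUnion fun i : (Σ r, Fin (b r)) => B i.1) (copies B b) where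
  white := ⟨fun x => ⟨x.1.1, x.1.2, x.2⟩, fun x => ⟨⟨x.1, x.2.1⟩, x.2.2⟩, fun _ => rfl, fun _ => rfl⟩
  black := ⟨fun x => ⟨x.1.1, x.1.2, x.2⟩, fun x => ⟨⟨x.1, x.2.1⟩, x.2.2⟩, fun _ => rfl, fun _ => rfl⟩
  edge _ _ := rfl

/-- Comparing the upper bound for a dominant `π` with the graphs glued on an arbitrary `σ'` shows
both that the bound is an equality and that `σ` is dominant on `A`. -/
theorem gaussianAtLargeN (hd : 0 < d) {R : Type} [Fintype R] [DecidableEq R]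
    {B : R → ColoredGraph d} {ω : R → ℕ} {ρ : ∀ r, (B r).White ≃ (B r).Black}
    (hT : ∀ r, (B r).Tight (ω r) (ρ r)) (hB : ∀ r, Nonempty (B r).White) :
    GaussianAtLargeN B := by
  rintro A hA b π ⟨hπ, hmax⟩
  set E := (IsoData.refl A).disjUnion (copiesIso B b)
  obtain ⟨π, rfl⟩ := E.pairing.surjective π
  have hAne := nonempty_white hd hA.nonempty
  have hlink : FeynmanLinked _ π := by
    have := ((mem_feynmanGraphs hd).1 hπ).2.iso E.symm
    have h2 : E.symm.pairing (E.pairing π) = π := by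
      refine Equiv.ext fun x => ?_
      have h3 := E.symm.pairing_apply (E.pairing π) (E.white x)
      rw [E.pairing_apply] at h3
      simpa [IsoData.symm] using h3
    rwa [h2] at this
  obtain ⟨σ, hle, heq⟩ := exists_labelled hd _ rfl
    (F := fun i : (Σ r, Fin (b r)) => B i.1) (fun i => hT i.1) (hlink.attached hd hAne
      (F := fun i : (Σ r, Fin (b r)) => B i.1) fun i => hB i.1)
  have hge : ∀ σ' : A.White ≃ A.Black, A.totalCycles σ' + ∑ i : (Σ r, Fin (b r)), ω i.1 ≤
      (A.disjUnion (famUnion fun i : (Σ r, Fin (b r)) => B i.1)).totalCycles π +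
        d * Fintype.card (Σ r, Fin (b r)) := by
    intro σ'
    obtain ⟨π', hπ', h⟩ := exists_feynmanLinked hd _ rfl
      (F := fun i : (Σ r, Fin (b r)) => B i.1) (fun i => hT i.1)
      (fun i => hB i.1) hAne (σ := σ') fun p q hpq _ => hA.linked p q hpq
    have := hmax (E.pairing π') ((mem_feynmanGraphs hd).2
      ⟨⟨inlW hAne.some⟩, hπ'.iso E⟩)
    rw [E.totalCycles_pairing, E.totalCycles_pairing] at this
    omega
  refine ((heq (le_antisymm hle (hge σ))).iso (copiesIso B b)).maximalTwoCut
    ⟨hA.mem_feynmanGraphs hd σ, fun σ' _ => ?_⟩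
  have := hge σ'
  omega

end ColoredGraph

/-! ### Gaussian integrals -/

namespace ComplexGaussian

theorem norm_monomial_mul_exp (m n : ℕ) (z : ℂ) :
    ‖z ^ m * conj z ^ n * Complex.exp (-(z * conj z))‖ =
      ‖z‖ ^ ((m + n : ℕ) : ℝ) * Real.exp (-‖z‖ ^ (2 : ℝ)) := by
  rw [Complex.mul_conj, Complex.normSq_eq_norm_sq, norm_mul, norm_mul, norm_pow, norm_pow,
    RCLike.norm_conj, ← pow_add, Real.rpow_natCast, Complex.norm_exp]
  norm_num [← Complex.ofReal_pow]

theorem integrable_monomial (m n : ℕ) :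
    Integrable fun z : ℂ => z ^ m * conj z ^ n * Complex.exp (-(z * conj z)) := by
  have hc : Continuous fun z : ℂ => z ^ m * conj z ^ n * Complex.exp (-(z * conj z)) := by
    fun_prop
  rw [← integrable_norm_iff hc.aestronglyMeasurable]
  simp only [norm_monomial_mul_exp]
  -- The integral of a non-integrable function is zero by convention, so the positive explicit Gamma
  -- value proves integrability.
  apply Integrable.of_integral_ne_zero
  have hq : (-2 : ℝ) < ((m + n : ℕ) : ℝ) := by
    have : (0 : ℝ) ≤ ((m + n : ℕ) : ℝ) := Nat.cast_nonneg _
    linarith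
  rw [Complex.integral_rpow_mul_exp_neg_rpow (by norm_num) hq]
  have := Real.Gamma_pos_of_pos (show 0 < (((m + n : ℕ) : ℝ) + 2) / 2 by linarith)
  positivity

theorem integral_monomial_self (n : ℕ) :
    ∫ z : ℂ, z ^ n * conj z ^ n * Complex.exp (-(z * conj z)) = (Real.pi : ℂ) * (n ! : ℂ) := by
  have h : ∀ z : ℂ, z ^ n * conj z ^ n * Complex.exp (-(z * conj z)) =
      ((‖z‖ ^ ((n + n : ℕ) : ℝ) * Real.exp (-‖z‖ ^ (2 : ℝ)) : ℝ) : ℂ) := by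
    intro z
    rw [← mul_pow, Complex.mul_conj, Complex.normSq_eq_norm_sq, Real.rpow_natCast, ← two_mul,
      pow_mul]
    push_cast
    norm_num
  simp only [h]
  have hq : (-2 : ℝ) < ((n + n : ℕ) : ℝ) := by
    have : (0 : ℝ) ≤ ((n + n : ℕ) : ℝ) := Nat.cast_nonneg _
    linarith
  rw [integral_complex_ofReal, Complex.integral_rpow_mul_exp_neg_rpow (by norm_num) hq]
  have : (((n + n : ℕ) : ℝ) + 2) / 2 = n + 1 := by push_cast; ring
  rw [this, Real.Gamma_nat_eq_factorial]
  push_cast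
  ring

theorem integral_monomial_of_ne {m n : ℕ} (h : m ≠ n) :
    ∫ z : ℂ, z ^ m * conj z ^ n * Complex.exp (-(z * conj z)) = 0 := by
  have hmn : ((m : ℂ) - n) ≠ 0 := by
    rw [sub_ne_zero]; exact_mod_cast h
  -- The angle is chosen so that rotating by `u` multiplies the monomial by `-1` and preserves
  -- measure and weight.
  let u := Circle.exp (Real.pi / ((m : ℝ) - n))
  have hu : (u : ℂ) ^ m * conj (u : ℂ) ^ n = -1 := by
    have h1 : conj (u : ℂ) = Complex.exp (-(((Real.pi / ((m : ℝ) - n) : ℝ) : ℂ) * Complex.I)) := by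
      simp only [u, Circle.coe_exp, ← Complex.exp_conj]
      congr 1
      simp
    rw [h1]
    simp only [u, Circle.coe_exp]
    rw [← Complex.exp_nat_mul, ← Complex.exp_nat_mul, ← Complex.exp_add, ← Complex.exp_pi_mul_I]
    congr 1
    push_cast
    field_simp
    ring
  have hmp := (rotation u).measurePreserving
  have hint := hmp.integral_comp (rotation u).toHomeomorph.measurableEmbedding
    fun z : ℂ => z ^ m * conj z ^ n * Complex.exp (-(z * conj z))
  have hrot : ∀ z : ℂ, (rotation u z) ^ m * conj (rotation u z) ^ n *
      Complex.exp (-(rotation u z * conj (rotation u z))) =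
      -(z ^ m * conj z ^ n * Complex.exp (-(z * conj z))) := by
    intro z
    have huu : (u : ℂ) * conj (u : ℂ) = 1 := by
      rw [Complex.mul_conj, Circle.normSq_coe, Complex.ofReal_one]
    rw [rotation_apply, map_mul]
    have : (u : ℂ) * z * (conj (u : ℂ) * conj z) = z * conj z := by
      linear_combination (z * conj z) * huu
    rw [this, mul_pow, mul_pow]
    linear_combination (z ^ m * conj z ^ n * Complex.exp (-(z * conj z))) * hu
  simp only [hrot, integral_neg] at hint
  exact self_eq_neg.1 hint.symm

variable {ι W K : Type} [Fintype ι] [DecidableEq ι] [Fintype W] [Fintype K]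

/-- A label-preserving bijection is a family of bijections between fibers. The product matches the
factorization of the Gaussian integral over the coordinates. -/
theorem card_matchings [DecidableEq W] [DecidableEq K] (a : W → ι) (b : K → ι) :
    Fintype.card {σ : W ≃ K // ∀ w, b (σ w) = a w} =
      ∏ α, if Fintype.card {w // a w = α} = Fintype.card {k // b k = α} then
        (Fintype.card {w // a w = α})! else 0 := by
  let e : {σ : W ≃ K // ∀ w, b (σ w) = a w} ≃ ∀ α, {w // a w = α} ≃ {k // b k = α} :=
    { toFun := fun σ α => σ.1.subtypeEquiv fun w => by rw [σ.2 w]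
      invFun := fun F => ⟨(Equiv.sigmaFiberEquiv a).symm.trans
        ((Equiv.sigmaCongrRight F).trans (Equiv.sigmaFiberEquiv b)), fun w => (F (a w) ⟨w, rfl⟩).2⟩
      left_inv := fun σ => by ext; rfl
      right_inv := fun F => by
        ext α ⟨w, rfl⟩
        rfl }
  rw [Fintype.card_congr e, Fintype.card_pi]
  refine Finset.prod_congr rfl fun α _ => ?_
  split_ifs with h
  · exact Fintype.card_equiv (Fintype.equivOfCardEq h)
  · rw [Fintype.card_eq_zero_iff]
    exact ⟨fun f => h (Fintype.card_congr f)⟩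

theorem monomial_eq (a : W → ι) (b : K → ι) (T : ι → ℂ) :
    (∏ w, T (a w)) * (∏ k, conj (T (b k))) * Complex.exp (-∑ α, T α * conj (T α)) =
      ∏ α, (T α ^ Fintype.card {w // a w = α} * conj (T α) ^ Fintype.card {k // b k = α} *
        Complex.exp (-(T α * conj (T α)))) := by
  have h : ∀ {V : Type} [Fintype V] (a : V → ι) (f : ι → ℂ),
      ∏ w, f (a w) = ∏ α, f α ^ Fintype.card {w // a w = α} := by
    intro V _ a f
    rw [← Finset.prod_fiberwise Finset.univ a]
    refine Finset.prod_congr rfl fun α _ => ?_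
    rw [Finset.prod_congr rfl (g := fun _ => f α) fun w hw => by
      rw [(Finset.mem_filter.1 hw).2], Finset.prod_const, Fintype.card_subtype]
  rw [h a T, h b fun α => conj (T α), ← Finset.sum_neg_distrib, Complex.exp_sum,
    ← Finset.prod_mul_distrib, ← Finset.prod_mul_distrib]

theorem integrable_wick (a : W → ι) (b : K → ι) : Integrable fun T : ι → ℂ =>
    (∏ w, T (a w)) * (∏ k, conj (T (b k))) * Complex.exp (-∑ α, T α * conj (T α)) := by
  simp only [monomial_eq]
  exact Integrable.fintype_prod (f := fun α z => z ^ Fintype.card {w // a w = α} *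
    conj z ^ Fintype.card {k // b k = α} * Complex.exp (-(z * conj z)))
    fun α => integrable_monomial _ _

/-- Wick's theorem. -/
theorem integral_wick [DecidableEq W] [DecidableEq K] (a : W → ι) (b : K → ι) :
    ∫ T : ι → ℂ, (∏ w, T (a w)) * (∏ k, conj (T (b k))) * Complex.exp (-∑ α, T α * conj (T α)) =
      (Real.pi : ℂ) ^ Fintype.card ι * Fintype.card {σ : W ≃ K // ∀ w, b (σ w) = a w} := by
  simp only [monomial_eq]
  rw [integral_fintype_prod_volume_eq_prod fun α z => z ^ Fintype.card {w // a w = α} *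
    conj z ^ Fintype.card {k // b k = α} * Complex.exp (-(z * conj z)), card_matchings]
  rw [Nat.cast_prod, ← Finset.card_univ, ← Finset.prod_const, ← Finset.prod_mul_distrib]
  refine Finset.prod_congr rfl fun α _ => ?_
  split_ifs with h
  · rw [← h, integral_monomial_self]
  · rw [integral_monomial_of_ne h]
    simp

end ComplexGaussian

/-! ### Wick expansion of bubble polynomials. -/

namespace ColoredGraph

variable {d : ℕ}

open Equiv Equiv.Perm

/-- The sum of `N ^ (number of bicolored cycles)` over all pairings. -/
noncomputable def wickSum (N : ℕ) (A : ColoredGraph d) : ℂ :=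
  ∑ π : A.White ≃ A.Black, (N : ℂ) ^ A.totalCycles π

theorem card_invariant {W : Type} [Finite W] (τ : Perm W) (N : ℕ) :
    Nat.card {j : W → Fin N // ∀ x, j (τ x) = j x} = N ^ numCycles τ := by
  let e : {j : W → Fin N // ∀ x, j (τ x) = j x} ≃ (Quotient (SameCycle.setoid τ) → Fin N) :=
    { toFun := fun j => Quotient.lift j.1 fun x y (h : SameCycle τ x y) => h.map_eq j.2
      invFun := fun f => ⟨fun x => f (Quotient.mk _ x), fun x => by
        beta_reduce; rw [mk_apply_eq]⟩
      left_inv := fun j => rfl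
      right_inv := fun f => funext fun q => q.inductionOn fun x => rfl }
  have : Finite (Quotient (SameCycle.setoid τ)) := Quotient.finite _
  rw [Nat.card_congr e, Nat.card_fun, Nat.card_fin, numCycles]

/-- Color by color, the indices compatible with `σ` are constant on bicolored cycles and free
otherwise, hence one factor `N` per cycle. -/
theorem card_compatible (A : ColoredGraph d) (N : ℕ) (σ : A.White ≃ A.Black) :
    Nat.card {i : Fin d → A.White → Fin N //
      ∀ w, (fun c => i c ((A.edge c).symm (σ w))) = fun c => i c w} = N ^ A.totalCycles σ := by
  have h : ∀ (c : Fin d) (j : A.White → Fin N), (∀ w, j ((A.edge c).symm (σ w)) = j w) ↔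
      ∀ x, j (((A.edge c).trans σ.symm) x) = j x := by
    intro c j
    constructor
    · intro h x
      have := h (((A.edge c).trans σ.symm) x)
      simpa using this.symm
    · intro h x
      have := h ((A.edge c).symm (σ x))
      simpa using this.symm
  let e₁ : {i : Fin d → A.White → Fin N //
      ∀ w, (fun c => i c ((A.edge c).symm (σ w))) = fun c => i c w} ≃
      {i : Fin d → A.White → Fin N // ∀ c, ∀ x, i c (((A.edge c).trans σ.symm) x) = i c x} :=
    Equiv.subtypeEquivRight fun i => by
      simp only [← h, funext_iff]
      exact forall_comm
  rw [Nat.card_congr (e₁.trans (Equiv.subtypePiEquivPi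
    (p := fun c (j : A.White → Fin N) => ∀ x, j (((A.edge c).trans σ.symm) x) = j x))),
    Nat.card_pi]
  simp only [card_invariant]
  rw [Finset.prod_pow_eq_pow_sum]
  rfl

theorem integrable_poly (A : ColoredGraph d) (N : ℕ) : Integrable
    fun T : (Fin d → Fin N) → ℂ => A.poly T * Complex.exp (-∑ a, T a * conj (T a)) := by
  unfold poly
  simp only [Finset.sum_mul]
  exact integrable_finsetSum _ fun i _ => ComplexGaussian.integrable_wick
    (fun w c => i c w) (fun k c => i c ((A.edge c).symm k))

theorem integral_poly (A : ColoredGraph d) (N : ℕ) :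
    ∫ T : (Fin d → Fin N) → ℂ, A.poly T * Complex.exp (-∑ a, T a * conj (T a)) =
      (Real.pi : ℂ) ^ N ^ d * wickSum N A := by
  unfold poly
  simp only [Finset.sum_mul]
  rw [integral_finsetSum _ fun i _ => ComplexGaussian.integrable_wick
    (fun w c => i c w) (fun k c => i c ((A.edge c).symm k))]
  simp only [ComplexGaussian.integral_wick]
  rw [← Finset.mul_sum]
  have hcard : Fintype.card (Fin d → Fin N) = N ^ d := by simp
  rw [hcard, ← Nat.cast_sum, wickSum]
  congr 1
  have hN : ∀ σ : A.White ≃ A.Black, (N : ℂ) ^ A.totalCycles σ = ((Fintype.card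
      {i : Fin d → A.White → Fin N //
        ∀ w, (fun c => i c ((A.edge c).symm (σ w))) = fun c => i c w} : ℕ) : ℂ) := by
    intro σ
    rw [← Nat.card_eq_fintype_card, card_compatible]
    push_cast
    rfl
  simp only [hN]
  rw [← Nat.cast_sum]
  simp only [Fintype.card_subtype, Finset.card_filter]
  rw [Finset.sum_comm]

theorem poly_disjUnion (A B : ColoredGraph d) {N : ℕ} (T : (Fin d → Fin N) → ℂ) :
    (A.disjUnion B).poly T = A.poly T * B.poly T := by
  unfold poly
  rw [Finset.sum_mul_sum, ← Finset.sum_product']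
  let e : (Fin d → (A.disjUnion B).White → Fin N) ≃
      (Fin d → A.White → Fin N) × (Fin d → B.White → Fin N) :=
    { toFun := fun i => (fun c w => i c (inlW w), fun c w => i c (inrW w))
      invFun := fun i c => (Sum.elim (i.1 c) (i.2 c) : A.White ⊕ B.White → Fin N)
      left_inv := fun i => by
        funext c x
        obtain ⟨x, rfl⟩ | ⟨x, rfl⟩ := white_cases x <;> rfl
      right_inv := fun i => rfl }
  refine Fintype.sum_equiv e _ _ fun i => ?_
  have h1 : ∀ f : (A.disjUnion B).White → ℂ,
      ∏ w, f w = (∏ w, f (inlW w)) * ∏ w, f (inrW w) :=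
    fun f => Fintype.prod_sum_type (α₁ := A.White) (α₂ := B.White) f
  have h2 : ∀ f : (A.disjUnion B).Black → ℂ,
      ∏ w, f w = (∏ w, f (inlB w)) * ∏ w, f (inrB w) :=
    fun f => Fintype.prod_sum_type (α₁ := A.Black) (α₂ := B.Black) f
  rw [h1, h2]
  have h3 : ∀ c (k : A.Black), ((A.disjUnion B).edge c).symm (inlB k) =
      inlW ((A.edge c).symm k) := fun _ _ => rfl
  have h4 : ∀ c (k : B.Black), ((A.disjUnion B).edge c).symm (inrB k) =
      inrW ((B.edge c).symm k) := fun _ _ => rfl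
  simp only [h3, h4]
  exact mul_mul_mul_comm _ _ _ _

theorem poly_famUnion {ι : Type} [Fintype ι] [DecidableEq ι] (F : ι → ColoredGraph d) {N : ℕ}
    (T : (Fin d → Fin N) → ℂ) : (famUnion F).poly T = ∏ i, (F i).poly T := by
  unfold poly
  rw [Finset.prod_univ_sum, Fintype.piFinset_univ]
  let e : (Fin d → (famUnion F).White → Fin N) ≃ ∀ i, Fin d → (F i).White → Fin N :=
    { toFun := fun i k c w => i c (famW k w)
      invFun := fun i c x => i x.1 c x.2
      left_inv := fun i => rfl
      right_inv := fun i => rfl }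
  refine Fintype.sum_equiv e _ _ fun i => ?_
  have h1 : ∀ f : (famUnion F).White → ℂ, ∏ w, f w = ∏ k, ∏ w, f (famW k w) :=
    fun f => Fintype.prod_sigma (α := fun k => (F k).White) f
  have h2 : ∀ f : (famUnion F).Black → ℂ, ∏ w, f w = ∏ k, ∏ w, f (famB k w) :=
    fun f => Fintype.prod_sigma (α := fun k => (F k).Black) f
  rw [h1, h2, ← Finset.prod_mul_distrib]
  rfl

end ColoredGraph

namespace ColoredGraph

variable {d : ℕ}

open Equiv Equiv.Perm

/-! ### Schwinger-Dyson equations -/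

/-- A contraction of the pair of vertices `w`, `k`. -/
noncomputable def contract (A : ColoredGraph d) (w : A.White) (k : A.Black) : ColoredGraph d :=
  (A.exists_contraction w k).choose

noncomputable def contraction (A : ColoredGraph d) (w : A.White) (k : A.Black) :
    Contraction A (A.contract w k) w k :=
  (A.exists_contraction w k).choose_spec.some

/-- A sum over all pairings, decomposed according to the partner of `w`. -/
theorem sum_pairings {A : ColoredGraph d} (w : A.White) {G : A.Black → ColoredGraph d}
    (κ : ∀ k, Contraction A (G k) w k) {M : Type*} [AddCommMonoid M]
    (f : (A.White ≃ A.Black) → M) :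
    ∑ π, f π = ∑ k, ∑ π : (G k).White ≃ (G k).Black, f ((κ k).extend π) := by
  rw [← Finset.sum_fiberwise Finset.univ fun π : A.White ≃ A.Black => π w]
  refine Finset.sum_congr rfl fun k _ => ?_
  symm
  refine Finset.sum_nbij (κ k).extend (fun π _ => by simp) (κ k).extend_injective.injOn
    (fun π hπ => ?_) fun _ _ => rfl
  obtain ⟨π', h⟩ := (κ k).exists_extend_eq (π := π) (by simpa using hπ)
  exact ⟨π', by simp, h⟩

theorem wickSum_eq_sum {A : ColoredGraph d} (N : ℕ) (w : A.White) {G : A.Black → ColoredGraph d}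
    (κ : ∀ k, Contraction A (G k) w k) :
    wickSum N A = ∑ k, (N : ℂ) ^ A.loops w k * wickSum N (G k) := by
  unfold wickSum
  rw [sum_pairings w κ]
  refine Finset.sum_congr rfl fun k _ => ?_
  rw [Finset.mul_sum]
  refine Finset.sum_congr rfl fun π _ => ?_
  rw [(κ k).totalCycles_extend, pow_add, mul_comm]

/-- Contracting `w` with a vertex of a copy merges only that copy into `A`. The others stay a
disjoint family, so the integrand keeps the form of a polynomial times a product of interactions. -/
theorem nonempty_contraction_famUnion {A : ColoredGraph d} {ι : Type} [Fintype ι] [DecidableEq ι]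
    (F : ι → ColoredGraph d) (w : A.White) (i : ι) (y : (F i).Black) :
    Nonempty (Contraction (A.disjUnion (famUnion F))
      (((A.disjUnion (F i)).contract (inlW w) (inrB y)).disjUnion
        (famUnion fun j : {j // j ≠ i} => F j)) (inlW w) (inrB (famB i y))) := by
  have h1 : (peel A F i).symm.white (inlW w) = inlW (inlW w) := by
    change (peel A F i).white.symm _ = _
    rw [Equiv.symm_apply_eq, peel_white_inl_inl]
  have h2 : (peel A F i).symm.black (inrB (famB i y)) = inlB (inrB y) := by
    change (peel A F i).black.symm _ = _
    rw [Equiv.symm_apply_eq, peel_black_inl_inr]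
  refine ⟨Contraction.ofIso (peel A F i).symm ?_⟩
  rw [h1, h2]
  exact (contraction _ _ _).inl _

theorem wickSum_disjUnion_famUnion {A : ColoredGraph d} {ι : Type} [Fintype ι] [DecidableEq ι]
    (F : ι → ColoredGraph d) (N : ℕ) (w : A.White) :
    wickSum N (A.disjUnion (famUnion F)) =
      ∑ k, (N : ℂ) ^ A.loops w k * wickSum N ((A.contract w k).disjUnion (famUnion F)) +
      ∑ i, ∑ y, wickSum N (((A.disjUnion (F i)).contract (inlW w) (inrB y)).disjUnion
        (famUnion fun j : {j // j ≠ i} => F j)) := by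
  let G : (A.disjUnion (famUnion F)).Black → ColoredGraph d :=
    (Sum.elim (fun k => (A.contract w k).disjUnion (famUnion F))
      (fun z => ((A.disjUnion (F z.1)).contract (inlW w) (inrB z.2)).disjUnion
        (famUnion fun j : {j // j ≠ z.1} => F j)) : A.Black ⊕ (Σ i, (F i).Black) → ColoredGraph d)
  have hκ : ∀ k, Nonempty (Contraction (A.disjUnion (famUnion F)) (G k) (inlW w) k) := by
    intro k
    obtain ⟨k, rfl⟩ | ⟨k, rfl⟩ := black_cases k
    · exact ⟨(A.contraction w k).inl _⟩
    · obtain ⟨i, y, rfl⟩ := famB_cases k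
      exact nonempty_contraction_famUnion F w i y
  rw [wickSum_eq_sum N (inlW w) fun k => (hκ k).some]
  have h1 : ∀ f : (A.disjUnion (famUnion F)).Black → ℂ,
      ∑ k, f k = ∑ k, f (inlB k) + ∑ i, ∑ y, f (inrB (famB i y)) := by
    intro f
    refine (Fintype.sum_sum_type (α₁ := A.Black) (α₂ := Σ i, (F i).Black) f).trans ?_
    congr 1
    exact Fintype.sum_sigma (α := fun k => (F k).Black) (fun z => f (inrB z))
  rw [h1]
  congr 1
  · refine Finset.sum_congr rfl fun k _ => ?_
    rw [loops_disjUnion_inl]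
    rfl
  · refine Finset.sum_congr rfl fun i _ => Finset.sum_congr rfl fun y _ => ?_
    rw [loops_disjUnion_inl_inr, pow_zero, one_mul]
    rfl

theorem integral_poly_mul_prod (A : ColoredGraph d) {ι : Type} [Fintype ι] [DecidableEq ι]
    (F : ι → ColoredGraph d) (N : ℕ) :
    ∫ T : (Fin d → Fin N) → ℂ, A.poly T * (∏ i, (F i).poly T) *
      Complex.exp (-∑ a, T a * conj (T a)) =
      (Real.pi : ℂ) ^ N ^ d * wickSum N (A.disjUnion (famUnion F)) := by
  rw [← integral_poly]
  simp only [poly_disjUnion, poly_famUnion]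

theorem integral_schwingerDyson {A : ColoredGraph d} {ι : Type} [Fintype ι] [DecidableEq ι]
    (F : ι → ColoredGraph d) (N : ℕ) (w : A.White) :
    ∫ T : (Fin d → Fin N) → ℂ, A.poly T * (∏ i, (F i).poly T) *
        Complex.exp (-∑ a, T a * conj (T a)) =
      ∑ k, (N : ℂ) ^ A.loops w k * (∫ T : (Fin d → Fin N) → ℂ,
        (A.contract w k).poly T * (∏ i, (F i).poly T) * Complex.exp (-∑ a, T a * conj (T a))) +
      ∑ i, ∑ y, ∫ T : (Fin d → Fin N) → ℂ,
        ((A.disjUnion (F i)).contract (inlW w) (inrB y)).poly T *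
          (∏ j : {j // j ≠ i}, (F j).poly T) * Complex.exp (-∑ a, T a * conj (T a)) := by
  rw [integral_poly_mul_prod, wickSum_disjUnion_famUnion F N w, mul_add, Finset.mul_sum,
    Finset.mul_sum]
  congr 1
  · refine Finset.sum_congr rfl fun k _ => ?_
    rw [integral_poly_mul_prod]
    ring
  · refine Finset.sum_congr rfl fun i _ => ?_
    rw [Finset.mul_sum]
    refine Finset.sum_congr rfl fun y _ => ?_
    rw [integral_poly_mul_prod]

theorem prod_comp_eq_prod_pow_card {ι R : Type} [Fintype ι] [Fintype R] [DecidableEq R]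
    {M : Type*} [CommMonoid M] (a : ι → R) (f : R → M) :
    ∏ i, f (a i) = ∏ r, f r ^ ∑ i, if a i = r then 1 else 0 := by
  rw [← Finset.prod_fiberwise Finset.univ a]
  refine Finset.prod_congr rfl fun r _ => ?_
  rw [Finset.prod_congr rfl (g := fun _ => f r) fun w hw => by
    rw [(Finset.mem_filter.1 hw).2], Finset.prod_const, Finset.card_filter]

theorem coeff_X_mul_eq {R : Type} (m : R →₀ ℕ) (r : R) (F : MvPowerSeries R ℂ) :
    MvPowerSeries.coeff m (MvPowerSeries.X r * F) =
      if m r = 0 then 0 else MvPowerSeries.coeff (m - Finsupp.single r 1) F := by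
  rw [MvPowerSeries.X, MvPowerSeries.coeff_monomial_mul]
  have : Finsupp.single r 1 ≤ m ↔ m r ≠ 0 := by
    rw [Finsupp.single_le_iff]
    omega
  by_cases h : m r = 0 <;> simp [this, h]

section Model

variable {R : Type} [Fintype R]

theorem sum_sigma_indicator [DecidableEq R] (m : R →₀ ℕ) (r : R) :
    (∑ i : (Σ r, Fin (m r)), if i.1 = r then 1 else 0) = m r := by
  rw [Fintype.sum_sigma, Finset.sum_eq_single r (fun x _ hx => by simp [hx]) (by simp)]
  simp

theorem sum_sigma_eq (m : R →₀ ℕ) (f : R → ℂ) :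
    ∑ i : (Σ r, Fin (m r)), f i.1 = ∑ r, m r * f r := by
  rw [Fintype.sum_sigma]
  simp

theorem prod_sigma_eq [DecidableEq R] (m : R →₀ ℕ) (f : R → ℂ) :
    ∏ i : (Σ r, Fin (m r)), f i.1 = ∏ r, f r ^ m r := by
  rw [prod_comp_eq_prod_pow_card (fun i : (Σ r, Fin (m r)) => i.1) f]
  simp only [sum_sigma_indicator]

theorem prod_sigma_ne_eq [DecidableEq R] (m : R →₀ ℕ) (f : R → ℂ) (i₀ : Σ r, Fin (m r)) :
    ∏ i : {i // i ≠ i₀}, f i.1.1 = ∏ r, f r ^ (m - Finsupp.single i₀.1 1 : R →₀ ℕ) r := by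
  rw [prod_comp_eq_prod_pow_card (fun i : {i // i ≠ i₀} => i.1.1) f]
  refine Finset.prod_congr rfl fun r _ => ?_
  congr 1
  have h := sum_sigma_indicator m r
  rw [Fintype.sum_eq_add_sum_subtype_ne _ i₀] at h
  rw [Finsupp.tsub_apply, Finsupp.single_apply]
  omega

/-- The coefficient of the perturbative expansion of the weight. -/
noncomputable def weightCoeff (s : R → ℤ) (N : ℕ) (m : R →₀ ℕ) : ℂ :=
  ∏ r, (-(N : ℂ) ^ s r) ^ m r / ((m r)! : ℂ)

theorem coeff_formalIntegral (B : R → ColoredGraph d) (s : R → ℤ) (N : ℕ)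
    (f : ((Fin d → Fin N) → ℂ) → ℂ) (m : R →₀ ℕ) :
    MvPowerSeries.coeff m (formalIntegral B s N f) = weightCoeff s N m *
      ∫ T : (Fin d → Fin N) → ℂ,
        f T * (∏ r, (B r).poly T ^ m r) * Complex.exp (-∑ a, T a * conj (T a)) := rfl

/-- The `m r` equivalent choices of a copy turn `1 / (m r)!` into `1 / (m r - 1)!`. One factor `-N ^
s r` splits off. -/
theorem weightCoeff_mul [DecidableEq R] (s : R → ℤ) (N : ℕ) (m : R →₀ ℕ) (r : R) (hr : m r ≠ 0) :
    weightCoeff s N m * (m r : ℂ) = -(N : ℂ) ^ s r * weightCoeff s N (m - Finsupp.single r 1) := by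
  unfold weightCoeff
  rw [← Finset.mul_prod_erase Finset.univ _ (Finset.mem_univ r),
    ← Finset.mul_prod_erase Finset.univ _ (Finset.mem_univ r)]
  have h : ∏ x ∈ Finset.univ.erase r, (-(N : ℂ) ^ s x) ^ (m - Finsupp.single r 1 : R →₀ ℕ) x /
      (((m - Finsupp.single r 1 : R →₀ ℕ) x)! : ℂ) =
      ∏ x ∈ Finset.univ.erase r, (-(N : ℂ) ^ s x) ^ m x / ((m x)! : ℂ) := by
    refine Finset.prod_congr rfl fun x hx => ?_
    rw [Finsupp.tsub_apply, Finsupp.single_eq_of_ne (Finset.ne_of_mem_erase hx), Nat.sub_zero]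
  rw [h]
  obtain ⟨n, hn⟩ := Nat.exists_eq_succ_of_ne_zero hr
  have h1 : (m - Finsupp.single r 1 : R →₀ ℕ) r = n := by
    rw [Finsupp.tsub_apply, Finsupp.single_eq_same, hn]; rfl
  rw [h1, hn, Nat.factorial_succ, pow_succ]
  have h2 : ((n : ℂ) + 1) ≠ 0 := Nat.cast_add_one_ne_zero n
  have h3 : (n ! : ℂ) ≠ 0 := by exact_mod_cast n.factorial_ne_zero
  push_cast
  field_simp

/-- Order by order, this sorts the pairings by the partner of `w`: a black vertex of `A`, or one of
an interaction copy, which is absorbed at the cost of one coupling constant. -/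
theorem formalIntegral_schwingerDyson [DecidableEq R] (B : R → ColoredGraph d) (s : R → ℤ) (N : ℕ)
    {A : ColoredGraph d} (w : A.White) :
    formalIntegral B s N (fun T => A.poly T) =
      ∑ k, MvPowerSeries.C ((N : ℂ) ^ A.loops w k) *
        formalIntegral B s N (fun T => (A.contract w k).poly T) -
      ∑ r, MvPowerSeries.X r * (MvPowerSeries.C ((N : ℂ) ^ s r) * ∑ y, formalIntegral B s N
        fun T => ((A.disjUnion (B r)).contract (inlW w) (inrB y)).poly T) := by
  ext m
  simp only [map_sub, map_sum, coeff_X_mul_eq, MvPowerSeries.coeff_C_mul, coeff_formalIntegral]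
  have h := integral_schwingerDyson (fun i : (Σ r, Fin (m r)) => B i.1) N w
  have h1 : ∀ T : (Fin d → Fin N) → ℂ, ∏ i : (Σ r, Fin (m r)), (B i.1).poly T =
      ∏ r, (B r).poly T ^ m r := fun T => prod_sigma_eq m fun r => (B r).poly T
  have h2 : ∀ (i₀ : Σ r, Fin (m r)) (T : (Fin d → Fin N) → ℂ),
      ∏ i : {i // i ≠ i₀}, (B i.1.1).poly T =
      ∏ r, (B r).poly T ^ (m - Finsupp.single i₀.1 1 : R →₀ ℕ) r :=
    fun i₀ T => prod_sigma_ne_eq m (fun r => (B r).poly T) i₀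
  simp only [h1, h2] at h
  rw [h, mul_add, Finset.mul_sum, sub_eq_add_neg]
  congr 1
  · exact Finset.sum_congr rfl fun k _ => by ring
  · rw [sum_sigma_eq m fun r => ∑ y, ∫ T : (Fin d → Fin N) → ℂ,
      ((A.disjUnion (B r)).contract (inlW w) (inrB y)).poly T *
        (∏ j, (B j).poly T ^ (m - Finsupp.single r 1 : R →₀ ℕ) j) *
          Complex.exp (-∑ a, T a * conj (T a)), Finset.mul_sum, ← Finset.sum_neg_distrib]
    refine Finset.sum_congr rfl fun r _ => ?_
    split_ifs with hr
    · simp [hr]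
    · rw [← mul_assoc, weightCoeff_mul s N m r hr, Finset.mul_sum, Finset.mul_sum,
        ← Finset.sum_neg_distrib]
      exact Finset.sum_congr rfl fun y _ => by ring

theorem expectation_schwingerDyson [DecidableEq R] (B : R → ColoredGraph d) (s : R → ℤ) (N : ℕ)
    {A : ColoredGraph d} (w : A.White) :
    expectation B s N (fun T => A.poly T) =
      ∑ k, MvPowerSeries.C ((N : ℂ) ^ A.loops w k) *
        expectation B s N (fun T => (A.contract w k).poly T) -
      ∑ r, MvPowerSeries.X r * (MvPowerSeries.C ((N : ℂ) ^ s r) * ∑ y, expectation B s N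
        fun T => ((A.disjUnion (B r)).contract (inlW w) (inrB y)).poly T) := by
  unfold expectation
  rw [formalIntegral_schwingerDyson B s N w, sub_mul, Finset.sum_mul, Finset.sum_mul]
  congr 1
  · exact Finset.sum_congr rfl fun k _ => by ring
  · refine Finset.sum_congr rfl fun r _ => ?_
    rw [← Finset.sum_mul]
    ring

theorem constantCoeff_formalIntegral_one (B : R → ColoredGraph d) (s : R → ℤ) (N : ℕ) :
    MvPowerSeries.constantCoeff (formalIntegral B s N fun _ => 1) = (Real.pi : ℂ) ^ N ^ d := by
  rw [← MvPowerSeries.coeff_zero_eq_constantCoeff_apply, coeff_formalIntegral]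
  have h := ComplexGaussian.integral_wick (ι := Fin d → Fin N) (Empty.elim) (Empty.elim)
  simp only [Finset.univ_eq_empty, Finset.prod_empty, one_mul] at h
  simp [weightCoeff, h]

theorem expectation_one (B : R → ColoredGraph d) (s : R → ℤ) (N : ℕ) :
    expectation B s N (fun _ => 1) = 1 := by
  refine MvPowerSeries.mul_inv_cancel _ ?_
  rw [constantCoeff_formalIntegral_one]
  exact pow_ne_zero _ (by exact_mod_cast Real.pi_ne_zero)

theorem poly_of_isEmpty {A : ColoredGraph d} [IsEmpty A.White] [IsEmpty A.Black] {N : ℕ}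
    (T : (Fin d → Fin N) → ℂ) : A.poly T = 1 := by
  unfold poly
  simp

end Model

end ColoredGraph

/-! ### A fixed point equation for formal power series -/

namespace MvPowerSeries

variable {R : Type}

/-- Equality of all coefficients of degree less than `k`. -/
def AgreeBelow (k : ℕ) (F G : MvPowerSeries R ℂ) : Prop :=
  ∀ m : R →₀ ℕ, m.degree < k → coeff m F = coeff m G

theorem AgreeBelow.mul {k : ℕ} {F F' G G' : MvPowerSeries R ℂ} (h : AgreeBelow k F G)
    (h' : AgreeBelow k F' G') : AgreeBelow k (F * F') (G * G') := by
  classical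
  intro m hm
  rw [coeff_mul, coeff_mul]
  refine Finset.sum_congr rfl fun p hp => ?_
  have hp' := congrArg Finsupp.degree (Finset.HasAntidiagonal.mem_antidiagonal.1 hp)
  rw [map_add] at hp'
  rw [h _ (by omega), h' _ (by omega)]

theorem AgreeBelow.pow {k : ℕ} {F G : MvPowerSeries R ℂ} (h : AgreeBelow k F G) (n : ℕ) :
    AgreeBelow k (F ^ n) (G ^ n) := by
  induction n with
  | zero => simp [AgreeBelow]
  | succ n ih =>
    rw [pow_succ, pow_succ]
    exact ih.mul h

theorem degree_sub_single {m : R →₀ ℕ} {r : R} (h : m r ≠ 0) :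
    (m - Finsupp.single r 1).degree + 1 = m.degree := by
  have h1 : Finsupp.single r 1 ≤ m := by
    rw [Finsupp.single_le_iff]
    omega
  conv_rhs => rw [← tsub_add_cancel_of_le h1, map_add, Finsupp.degree_single]

variable [Fintype R]

/-- The right-hand side of the fixed point equation of the covariance. -/
noncomputable def melonicMap (a : R → ℂ) (n : R → ℕ) (F : MvPowerSeries R ℂ) :
    MvPowerSeries R ℂ :=
  1 - ∑ r, C (a r) * X r * F ^ n r

theorem coeff_C_mul_X_mul {R : Type} (m : R →₀ ℕ) (z : ℂ) (r : R) (F : MvPowerSeries R ℂ) :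
    coeff m (C z * X r * F) =
      if m r = 0 then 0 else z * coeff (m - Finsupp.single r 1) F := by
  rw [mul_assoc, coeff_C_mul, ColoredGraph.coeff_X_mul_eq, mul_ite, mul_zero]

/-- The factors `X r` raise the degree by one, so the map is a contraction for the degree
filtration. Its iterates stabilize coefficientwise to a fixed point. -/
theorem AgreeBelow.melonicMap {k : ℕ} {F G : MvPowerSeries R ℂ} (h : AgreeBelow k F G)
    (a : R → ℂ) (n : R → ℕ) : AgreeBelow (k + 1) (melonicMap a n F) (melonicMap a n G) := by
  intro m hm
  simp only [MvPowerSeries.melonicMap, map_sub, map_sum, coeff_C_mul_X_mul]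
  congr 1
  refine Finset.sum_congr rfl fun r _ => ?_
  split_ifs with hr
  · rfl
  · have := degree_sub_single hr
    rw [h.pow (n r) _ (by omega)]

theorem exists_melonicMap_eq (a : R → ℂ) (n : R → ℕ) :
    ∃ F : MvPowerSeries R ℂ, F = melonicMap a n F := by
  have h1 : ∀ i j, AgreeBelow j ((melonicMap a n)^[j + i] 1) ((melonicMap a n)^[j] 1) := by
    intro i j
    induction j with
    | zero => exact fun m hm => absurd hm (Nat.not_lt_zero _)
    | succ j ih =>
      rw [Nat.succ_add, Function.iterate_succ_apply', Function.iterate_succ_apply']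
      exact ih.melonicMap a n
  let F : MvPowerSeries R ℂ := fun m => coeff m ((melonicMap a n)^[m.degree + 1] 1)
  have h2 : ∀ k, AgreeBelow k F ((melonicMap a n)^[k] 1) := by
    intro k m hm
    obtain ⟨i, rfl⟩ := Nat.exists_eq_add_of_lt hm
    have := h1 i (m.degree + 1) m (Nat.lt_succ_self _)
    rw [Nat.add_right_comm] at this
    exact this.symm
  refine ⟨F, ?_⟩
  ext m
  rw [h2 (m.degree + 1) m (Nat.lt_succ_self _), Function.iterate_succ_apply']
  exact ((h2 m.degree).melonicMap a n m (Nat.lt_succ_self _)).symm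

end MvPowerSeries

namespace ColoredGraph

variable {d : ℕ}

open Equiv Equiv.Perm

/-! ### Large `N` asymptotics -/

/-- The number of pairings with `D` bicolored cycles. -/
noncomputable def countPairings (A : ColoredGraph d) (D : ℤ) : ℕ :=
  (Finset.univ.filter fun π : A.White ≃ A.Black => (A.totalCycles π : ℤ) = D).card

theorem countPairings_eq_sum {A : ColoredGraph d} (w : A.White) (D : ℤ) :
    A.countPairings D = ∑ k, (A.contract w k).countPairings (D - A.loops w k) := by
  unfold countPairings
  simp only [Finset.card_filter]
  rw [sum_pairings w (contraction A w)]
  refine Finset.sum_congr rfl fun k _ => Finset.sum_congr rfl fun π _ => ?_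
  rw [(contraction A w k).totalCycles_extend]
  refine if_congr ?_ rfl rfl
  push_cast
  omega

theorem totalCycles_contract_le {A : ColoredGraph d} {D : ℤ}
    (hD : ∀ π, (A.totalCycles π : ℤ) ≤ D) (w : A.White) (k : A.Black)
    (π : (A.contract w k).White ≃ (A.contract w k).Black) :
    ((A.contract w k).totalCycles π : ℤ) ≤ D - A.loops w k := by
  have := hD ((contraction A w k).extend π)
  rw [(contraction A w k).totalCycles_extend] at this
  push_cast at this
  omega

/-- Absorbing `B` costs at least `d - ω` cycles, which is exactly compensated by the power of `N` of
the coupling. -/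
theorem Tight.totalCycles_contract_le {A B : ColoredGraph d} {ω : ℕ} {ρ : B.White ≃ B.Black}
    (h : B.Tight ω ρ) {D : ℤ} (hD : ∀ π, (A.totalCycles π : ℤ) ≤ D) (w : A.White) (y : B.Black)
    (π : ((A.disjUnion B).contract (inlW w) (inrB y)).White ≃
      ((A.disjUnion B).contract (inlW w) (inrB y)).Black) :
    (((A.disjUnion B).contract (inlW w) (inrB y)).totalCycles π : ℤ) ≤ D - (d - ω) := by
  have h1 := (ColoredGraph.contraction (A.disjUnion B) (inlW w) (inrB y)).totalCycles_extend π
  obtain ⟨π', a, b, h2, -⟩ := h.cross A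
    ((ColoredGraph.contraction (A.disjUnion B) (inlW w) (inrB y)).extend π) w y (Contraction.extend_apply _ _)
  have h3 := hD π'
  rw [loops_disjUnion_inl_inr] at h1
  omega

/-- The pairings counted on the left are those of `A ⊔ B` that join `w` to `y` and reach the
extremal count. By tightness they are exactly the `glue π ρ w (ρ.symm y)` with `π` optimal on `A`.
-/
theorem Tight.countPairings_contract {A B : ColoredGraph d} {ω : ℕ} {ρ : B.White ≃ B.Black}
    (h : B.Tight ω ρ) {D : ℤ} (hD : ∀ π, (A.totalCycles π : ℤ) ≤ D) (w : A.White)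
    (y : B.Black) :
    ((A.disjUnion B).contract (inlW w) (inrB y)).countPairings (D - (d - ω)) =
      A.countPairings D := by
  set κ := ColoredGraph.contraction (A.disjUnion B) (inlW w) (inrB y)
  have h1 := κ.totalCycles_extend
  rw [loops_disjUnion_inl_inr] at h1
  trans (Finset.univ.filter fun π : (A.disjUnion B).White ≃ (A.disjUnion B).Black =>
    π (inlW w) = inrB y ∧ ((A.disjUnion B).totalCycles π : ℤ) = D - (d - ω)).card
  · refine Finset.card_nbij κ.extend (fun π hπ => ?_) κ.extend_injective.injOn fun π hπ => ?_
    · have := (Finset.mem_filter.1 hπ).2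
      refine Finset.mem_filter.2 ⟨Finset.mem_univ _, κ.extend_apply π, ?_⟩
      rw [h1, add_zero, this]
    · obtain ⟨h2, h3⟩ := (Finset.mem_filter.1 hπ).2
      obtain ⟨π', rfl⟩ := κ.exists_extend_eq h2
      refine ⟨π', Finset.mem_filter.2 ⟨Finset.mem_univ _, ?_⟩, rfl⟩
      rw [← h3, h1, add_zero]
  · symm
    refine Finset.card_nbij (fun π => glue π ρ w (ρ.symm y)) (fun π hπ => ?_)
      (fun π _ π' _ => glue_injective (π := π) (ρ := ρ) (a := w) (b := ρ.symm y)) fun π hπ => ?_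
    · have h2 := (Finset.mem_filter.1 hπ).2
      have h3 := totalCycles_glue π ρ w (ρ.symm y)
      rw [h.cycles] at h3
      refine Finset.mem_filter.2 ⟨Finset.mem_univ _, ?_, by dsimp only; omega⟩
      rw [glue_inl_self, Equiv.apply_symm_apply]
    · obtain ⟨h2, h3⟩ := (Finset.mem_filter.1 hπ).2
      obtain ⟨π', a, b, h4, h5⟩ := h.cross A π w y h2
      have h6 := hD π'
      have h7 := h5 (by omega)
      have ha : w = a := by
        by_contra hne
        rw [h7, glue_inl _ _ _ _ hne] at h2
        exact absurd h2 (by simp)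
      subst ha
      rw [h7, glue_inl_self, inrB_inj] at h2
      subst h2
      refine ⟨π', Finset.mem_filter.2 ⟨Finset.mem_univ _, by omega⟩, ?_⟩
      simp [h7]

theorem card_contract {A : ColoredGraph d} (w : A.White) (k : A.Black) :
    Fintype.card (A.contract w k).White + 1 = Fintype.card A.White := by
  rw [← Fintype.card_congr (contraction A w k).white, Fintype.card_option]

end ColoredGraph

namespace ColoredGraph

variable {d : ℕ}

open Equiv Equiv.Perm

/-- The deviation of a rescaled coefficient of an expectation from its conjectured limit. -/
noncomputable def deviation {R : Type} [Fintype R] (B : R → ColoredGraph d) (s : R → ℤ)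
    (C : MvPowerSeries R ℂ) (m : R →₀ ℕ) (A : ColoredGraph d) (D : ℤ) (N : ℕ) : ℂ :=
  (N : ℂ) ^ (-D) * MvPowerSeries.coeff m (expectation B s N fun T => A.poly T) -
    A.countPairings D * MvPowerSeries.coeff m (C ^ Fintype.card A.White)

section Model

variable {R : Type} [Fintype R]

/-- The only pairing is empty, with no cycle, and the expectation is that of `1`. The deviation
vanishes for `D = 0` and is at most of order `N ^ (-D)` for `D > 0`. -/
theorem deviation_of_isEmpty (hd : 0 < d) (B : R → ColoredGraph d) (s : R → ℤ)
    (C : MvPowerSeries R ℂ) (m : R →₀ ℕ) {A : ColoredGraph d} (hA : IsEmpty A.White) {D : ℤ}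
    (hD : ∀ π, (A.totalCycles π : ℤ) ≤ D) :
    deviation B s C m A D =O[atTop] fun N : ℕ => ((N : ℝ))⁻¹ := by
  have hA' : IsEmpty A.Black := (A.edge ⟨0, hd⟩).symm.isEmpty
  have h1 : ∀ N, deviation B s C m A D N = (N : ℂ) ^ (-D) * MvPowerSeries.coeff m 1 -
      A.countPairings D * MvPowerSeries.coeff m 1 := by
    intro N
    simp only [deviation, poly_of_isEmpty, expectation_one, Fintype.card_eq_zero, pow_zero]
  have h0 : (0 : ℤ) ≤ D := by
    have := hD (A.edge ⟨0, hd⟩)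
    omega
  obtain rfl | h0 := h0.eq_or_lt
  · have h2 : A.countPairings 0 = 1 := by
      unfold countPairings
      simp only [totalCycles_of_isEmpty]
      simp [Fintype.card_equiv (A.edge ⟨0, hd⟩)]
    have h3 : deviation B s C m A 0 = fun _ => 0 := by
      funext N
      simp [h1, h2]
    rw [h3]
    exact isBigO_zero _ _
  · have h2 : A.countPairings D = 0 := by
      unfold countPairings
      simp only [totalCycles_of_isEmpty]
      simp [h0.ne]
    refine IsBigO.of_bound ‖(MvPowerSeries.coeff m (1 : MvPowerSeries R ℂ))‖ ?_
    filter_upwards [eventually_ge_atTop 1] with N hN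
    have hN' : (1 : ℝ) ≤ N := by exact_mod_cast hN
    rw [h1, h2, Nat.cast_zero, zero_mul, sub_zero, norm_mul, mul_comm, norm_zpow,
      Complex.norm_natCast, norm_inv, Real.norm_natCast, ← zpow_neg_one]
    gcongr
    omega

/-- The expectation and its conjectured limit satisfy the same recursion, hence so does their
difference. `D` need only be an upper bound, so that it can be passed on to contractions that do not
reach it. -/
theorem deviation_eq_sum [DecidableEq R] {B : R → ColoredGraph d} {ω : R → ℕ}
    {ρ : ∀ r, (B r).White ≃ (B r).Black} (hT : ∀ r, (B r).Tight (ω r) (ρ r))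
    {C : MvPowerSeries R ℂ}
    (hC : C = MvPowerSeries.melonicMap (fun r => (Fintype.card (B r).White : ℂ))
      (fun r => Fintype.card (B r).White) C) (m : R →₀ ℕ) {A : ColoredGraph d} (w : A.White)
    {D : ℤ} (hD : ∀ π, (A.totalCycles π : ℤ) ≤ D) (hd : 0 < d) {N : ℕ} (hN : N ≠ 0) :
    deviation B (fun r => d - ω r) C m A D N =
      ∑ k, deviation B (fun r => d - ω r) C m (A.contract w k) (D - A.loops w k) N -
      ∑ r, ∑ y, if m r = 0 then 0 else deviation B (fun r => d - ω r) C (m - Finsupp.single r 1)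
        ((A.disjUnion (B r)).contract (inlW w) (inrB y)) (D - (d - ω r)) N := by
  have hN' : (N : ℂ) ≠ 0 := by exact_mod_cast hN
  obtain ⟨n, hn⟩ := Nat.exists_eq_succ_of_ne_zero (Fintype.card_pos_iff.2 ⟨w⟩).ne'
  have hc1 : ∀ k, Fintype.card (A.contract w k).White = n := fun k => by
    have := card_contract w k
    omega
  have hc2 : ∀ r y, Fintype.card ((A.disjUnion (B r)).contract (inlW w) (inrB y)).White =
      n + Fintype.card (B r).White := fun r y => by
    have h1 := card_contract (A := A.disjUnion (B r)) (inlW w) (inrB y)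
    have h2 : Fintype.card (A.disjUnion (B r)).White =
      Fintype.card A.White + Fintype.card (B r).White := Fintype.card_sum
    omega
  -- The fixed point equation multiplied by `C ^ n`; its coefficient counts the black vertices `y`
  -- of `B r`.
  have hpow : C ^ (n + 1) = C ^ n - ∑ r, MvPowerSeries.C (Fintype.card (B r).White : ℂ) *
      MvPowerSeries.X r * C ^ (n + Fintype.card (B r).White) := by
    rw [pow_succ]
    nth_rewrite 2 [hC]
    rw [MvPowerSeries.melonicMap, mul_sub, mul_one, Finset.mul_sum]
    congr 1
    exact Finset.sum_congr rfl fun r _ => by ring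
  have hR : (A.countPairings D : ℂ) * MvPowerSeries.coeff m (C ^ Fintype.card A.White) =
      ∑ k, ((A.contract w k).countPairings (D - A.loops w k) : ℂ) *
        MvPowerSeries.coeff m (C ^ n) -
      ∑ r, ∑ y : (B r).Black, if m r = 0 then 0 else (A.countPairings D : ℂ) *
        MvPowerSeries.coeff (m - Finsupp.single r 1) (C ^ (n + Fintype.card (B r).White)) := by
    rw [hn, Nat.succ_eq_add_one, hpow, map_sub, mul_sub, ← Finset.sum_mul, ← Nat.cast_sum,
      ← countPairings_eq_sum, map_sum, Finset.mul_sum]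
    congr 1
    refine Finset.sum_congr rfl fun r _ => ?_
    rw [MvPowerSeries.coeff_C_mul_X_mul, Finset.sum_const, Finset.card_univ,
      ← card_white_eq_card_black hd, nsmul_eq_mul]
    split_ifs <;> ring
  unfold deviation
  simp only [hR, hc1, hc2, fun r y => (hT r).countPairings_contract hD w y]
  rw [expectation_schwingerDyson B _ N w]
  simp only [map_sub, map_sum, MvPowerSeries.coeff_C_mul, coeff_X_mul_eq]
  have h3 : ∀ (a b : ℂ) (p : Prop) [Decidable p],
      (if p then (0 : ℂ) else a - b) = (if p then 0 else a) - if p then 0 else b := by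
    intro a b p _
    split_ifs <;> simp
  simp only [h3, Finset.sum_sub_distrib]
  have h4 : ∀ l : ℕ, (N : ℂ) ^ (-(D - l)) = (N : ℂ) ^ (-D) * (N : ℂ) ^ l := fun l => by
    rw [neg_sub, sub_eq_neg_add, zpow_add₀ hN', zpow_natCast]
  have h5 : ∀ l : ℤ, (N : ℂ) ^ (-(D - l)) = (N : ℂ) ^ (-D) * (N : ℂ) ^ l := fun l => by
    rw [neg_sub, sub_eq_neg_add, zpow_add₀ hN']
  simp only [h4, fun r => h5 ((d : ℤ) - ω r)]
  rw [mul_sub, Finset.mul_sum, Finset.mul_sum]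
  have h6 : ∀ a b c e a' b' : ℂ, a = a' → b = b' → a - b - (c - e) = a' - c - (b' - e) := by
    rintro a b c e _ _ rfl rfl
    ring
  refine h6 _ _ _ _ _ _ ?_ ?_
  · exact Finset.sum_congr rfl fun k _ => by ring
  · refine Finset.sum_congr rfl fun r _ => ?_
    split_ifs with hr
    · simp
    · rw [Finset.mul_sum, Finset.mul_sum]
      exact Finset.sum_congr rfl fun k _ => by ring

/-- The leading order of the expectation of a polynomial is given by the pairings with the largest
number of bicolored cycles, each of them contributing a factor `C` per edge. -/
theorem deviation_isBigO [DecidableEq R] (hd : 0 < d) {B : R → ColoredGraph d} {ω : R → ℕ}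
    {ρ : ∀ r, (B r).White ≃ (B r).Black} (hT : ∀ r, (B r).Tight (ω r) (ρ r))
    {C : MvPowerSeries R ℂ}
    (hC : C = MvPowerSeries.melonicMap (fun r => (Fintype.card (B r).White : ℂ))
      (fun r => Fintype.card (B r).White) C) (m : R →₀ ℕ) (A : ColoredGraph d) (D : ℤ)
    (hD : ∀ π, (A.totalCycles π : ℤ) ≤ D) :
    deviation B (fun r => d - ω r) C m A D =O[atTop] fun N : ℕ => ((N : ℝ))⁻¹ := by
  -- Absorbing an interaction enlarges `A` but lowers the degree, and contracting within `A` lowers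
  -- its size at fixed degree: the induction is lexicographic.
  induction hq : m.degree using Nat.strong_induction_on generalizing m A D with
  | _ q ih₁ =>
    induction hn : Fintype.card A.White generalizing A D with
    | zero => exact deviation_of_isEmpty hd B _ C m (Fintype.card_eq_zero_iff.1 hn) hD
    | succ n ih₂ =>
      obtain ⟨w⟩ : Nonempty A.White := Fintype.card_pos_iff.1 (by omega)
      have h1 : deviation B (fun r => d - ω r) C m A D =ᶠ[atTop] fun N => _ :=
        (eventually_ge_atTop 1).mono fun N hN =>
          deviation_eq_sum hT hC m w hD hd (Nat.one_le_iff_ne_zero.1 hN)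
      refine IsBigO.congr' ?_ h1.symm (EventuallyEq.refl _ _)
      refine IsBigO.sub (IsBigO.fun_sum fun k _ => ?_)
        (IsBigO.fun_sum fun r _ => IsBigO.fun_sum fun y _ => ?_)
      · refine ih₂ _ _ (totalCycles_contract_le hD w k) ?_
        have := card_contract w k
        omega
      · split_ifs with hr
        · exact isBigO_zero _ _
        · have := MvPowerSeries.degree_sub_single hr
          exact ih₁ _ (by omega) _ _ _ ((hT r).totalCycles_contract_le hD w y) rfl

end Model

end ColoredGraph

namespace ColoredGraph

variable {d : ℕ}

open Equiv Equiv.Perm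

/-! ### The covariance -/

theorem poly_twoVertex {N : ℕ} (T : (Fin d → Fin N) → ℂ) :
    (twoVertex d).poly T = ∑ a, T a * conj (T a) := by
  unfold poly
  let e : (Fin d → (twoVertex d).White → Fin N) ≃ (Fin d → Fin N) :=
    { toFun := fun i c => i c ()
      invFun := fun a c _ => a c
      left_inv := fun _ => rfl
      right_inv := fun _ => rfl }
  refine Fintype.sum_equiv e _ _ fun i => ?_
  rw [Fintype.prod_unique, Fintype.prod_unique]
  rfl

theorem poly_reindex {N : ℕ} (σ : Fin d → Perm (Fin N)) (A : ColoredGraph d)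
    (T : (Fin d → Fin N) → ℂ) : A.poly (fun b => T fun c => σ c (b c)) = A.poly T := by
  unfold poly
  let e : (Fin d → A.White → Fin N) ≃ (Fin d → A.White → Fin N) :=
    Equiv.piCongrRight fun c => Equiv.piCongrRight fun _ => σ c
  exact Fintype.sum_equiv e _ _ fun i => rfl

/-- Each value of a `c`-th index occurs once in a `T` and once in a conjugate, so the phases cancel
in pairs. -/
theorem poly_mul_sign {N : ℕ} (ε : Fin N → ℂ) (hε : ∀ j, ε j * conj (ε j) = 1) (c : Fin d)
    (A : ColoredGraph d) (T : (Fin d → Fin N) → ℂ) :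
    A.poly (fun b => ε (b c) * T b) = A.poly T := by
  unfold poly
  refine Finset.sum_congr rfl fun i _ => ?_
  simp only [map_mul, Finset.prod_mul_distrib]
  have h1 : (∏ w, ε (i c w)) * ∏ k, conj (ε (i c ((A.edge c).symm k))) = 1 := by
    rw [← (A.edge c).prod_comp, ← Finset.prod_mul_distrib]
    simp [hε]
  rw [mul_mul_mul_comm, h1, one_mul]

section Model

variable {R : Type} [Fintype R]

theorem formalIntegral_comp (B : R → ColoredGraph d) (s : R → ℤ) {N : ℕ}
    (Φ : ((Fin d → Fin N) → ℂ) ≃ᵐ ((Fin d → Fin N) → ℂ)) (hΦ : MeasurePreserving Φ)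
    (hp : ∀ (A : ColoredGraph d) T, A.poly (Φ T) = A.poly T)
    (f : ((Fin d → Fin N) → ℂ) → ℂ) :
    formalIntegral B s N (fun T => f (Φ T)) = formalIntegral B s N f := by
  ext m
  rw [coeff_formalIntegral, coeff_formalIntegral]
  -- The quadratic form in the weight is itself a bubble polynomial, so `hp` covers its invariance
  -- too.
  simp only [← poly_twoVertex]
  have h := hΦ.integral_comp' fun T => f T * (∏ r, (B r).poly T ^ m r) *
    Complex.exp (-(twoVertex d).poly T)
  simp only [hp] at h
  rw [h]

theorem formalIntegral_covariance_of_ne (B : R → ColoredGraph d) (s : R → ℤ) {N : ℕ}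
    {a a' : Fin d → Fin N} (h : a ≠ a') :
    formalIntegral B s N (fun T => T a * conj (T a')) = 0 := by
  obtain ⟨c, hc⟩ := Function.ne_iff.1 h
  -- A sign change of the components whose index of color `c` is `a c`: it flips `T a` but not `T
  -- a'`.
  let Φ : ((Fin d → Fin N) → ℂ) ≃ᵐ ((Fin d → Fin N) → ℂ) := MeasurableEquiv.piCongrRight fun b =>
    if b c = a c then MeasurableEquiv.neg ℂ else MeasurableEquiv.refl ℂ
  have hΦ : MeasurePreserving Φ := by
    refine volume_preserving_pi fun b => ?_
    change MeasurePreserving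
      (if b c = a c then MeasurableEquiv.neg ℂ else MeasurableEquiv.refl ℂ : ℂ ≃ᵐ ℂ)
    split_ifs
    · exact Measure.measurePreserving_neg _
    · exact MeasurePreserving.id _
  have hv : ∀ T, Φ T = fun b => (if b c = a c then -1 else 1 : ℂ) * T b := by
    intro T
    funext b
    change (if b c = a c then MeasurableEquiv.neg ℂ else MeasurableEquiv.refl ℂ) (T b) = _
    split_ifs
    · exact (neg_one_mul _).symm
    · exact (one_mul _).symm
  have h1 := formalIntegral_comp B s Φ hΦ (fun A T => by
    rw [hv]
    exact poly_mul_sign (fun j => if j = a c then -1 else 1) (fun j => by split_ifs <;> simp) c A T)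
    (fun T => T a * conj (T a'))
  ext m
  have h2 := congrArg (MvPowerSeries.coeff m) h1
  simp only [hv, if_neg hc.symm, if_true, one_mul, neg_mul, coeff_formalIntegral,
    integral_neg, mul_neg] at h2
  rw [coeff_formalIntegral, map_zero]
  exact self_eq_neg.1 h2.symm

theorem formalIntegral_covariance_self (B : R → ColoredGraph d) (s : R → ℤ) {N : ℕ}
    (a a' : Fin d → Fin N) :
    formalIntegral B s N (fun T => T a * conj (T a)) =
      formalIntegral B s N (fun T => T a' * conj (T a')) := by
  let σ : Fin d → Perm (Fin N) := fun c => swap (a' c) (a c)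
  let e : Perm (Fin d → Fin N) := Equiv.piCongrRight σ
  let Φ : ((Fin d → Fin N) → ℂ) ≃ᵐ ((Fin d → Fin N) → ℂ) :=
    MeasurableEquiv.arrowCongr' e.symm (MeasurableEquiv.refl ℂ)
  have hv : ∀ T, Φ T = fun b => T fun c => σ c (b c) := fun T => rfl
  have h1 := formalIntegral_comp B s Φ
    (volume_preserving_arrowCongr' _ _ (MeasurePreserving.id _))
    (fun A T => by rw [hv, poly_reindex]) (fun T => T a' * conj (T a'))
  rw [← h1]
  simp [hv, σ]

/-- Dominated by the two-vertex polynomial, since `|T a|² ≤ ∑ b, |T b|²`. -/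
theorem integrable_covariance [DecidableEq R] (B : R → ColoredGraph d) (m : R →₀ ℕ) {N : ℕ}
    (a : Fin d → Fin N) :
    Integrable fun T : (Fin d → Fin N) → ℂ => T a * conj (T a) * (∏ r, (B r).poly T ^ m r) *
      Complex.exp (-∑ a, T a * conj (T a)) := by
  have h := integrable_poly
    ((twoVertex d).disjUnion (famUnion fun i : (Σ r, Fin (m r)) => B i.1)) N
  simp only [poly_disjUnion, poly_famUnion, poly_twoVertex] at h
  have h1 : ∀ T : (Fin d → Fin N) → ℂ, ∏ i : (Σ r, Fin (m r)), (B i.1).poly T =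
      ∏ r, (B r).poly T ^ m r := fun T => prod_sigma_eq m fun r => (B r).poly T
  simp only [h1] at h
  refine h.mono ?_ (Filter.Eventually.of_forall fun T => ?_)
  · refine Continuous.aestronglyMeasurable ?_
    unfold poly
    fun_prop
  · rw [norm_mul _ (Complex.exp _), norm_mul _ (Complex.exp _), norm_mul _ (∏ r, _),
      norm_mul _ (∏ r, _)]
    gcongr
    simp only [Complex.mul_conj, Complex.norm_real, ← Complex.ofReal_sum, Real.norm_eq_abs]
    rw [abs_of_nonneg (Complex.normSq_nonneg _),
      abs_of_nonneg (Finset.sum_nonneg fun b _ => Complex.normSq_nonneg _)]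
    exact Finset.single_le_sum (f := fun b => Complex.normSq (T b))
      (fun b _ => Complex.normSq_nonneg _) (Finset.mem_univ a)

theorem formalIntegral_twoVertex [DecidableEq R] (B : R → ColoredGraph d) (s : R → ℤ) {N : ℕ}
    (a : Fin d → Fin N) :
    formalIntegral B s N (fun T => (twoVertex d).poly T) =
      MvPowerSeries.C ((N : ℂ) ^ d) * formalIntegral B s N (fun T => T a * conj (T a)) := by
  have h1 : formalIntegral B s N (fun T => (twoVertex d).poly T) =
      ∑ b, formalIntegral B s N (fun T => T b * conj (T b)) := by
    ext m
    simp only [map_sum, coeff_formalIntegral, poly_twoVertex]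
    rw [← Finset.mul_sum, ← integral_finsetSum _ fun b _ => integrable_covariance B m b]
    simp only [Finset.sum_mul]
  rw [h1, Finset.sum_congr rfl fun b _ => formalIntegral_covariance_self B s b a,
    Finset.sum_const, Finset.card_univ, Fintype.card_fun, Fintype.card_fin, Fintype.card_fin,
    nsmul_eq_mul]
  simp

theorem expectation_covariance_of_ne (B : R → ColoredGraph d) (s : R → ℤ) {N : ℕ}
    {a a' : Fin d → Fin N} (h : a ≠ a') :
    expectation B s N (fun T => T a * conj (T a')) = 0 := by
  rw [expectation, formalIntegral_covariance_of_ne B s h, zero_mul]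

theorem coeff_expectation_covariance_self [DecidableEq R] (B : R → ColoredGraph d) (s : R → ℤ)
    {N : ℕ} (hN : N ≠ 0) (a : Fin d → Fin N) (m : R →₀ ℕ) :
    MvPowerSeries.coeff m (expectation B s N fun T => T a * conj (T a)) =
      (N : ℂ) ^ (-(d : ℤ)) *
        MvPowerSeries.coeff m (expectation B s N fun T => (twoVertex d).poly T) := by
  have hN' : (N : ℂ) ≠ 0 := by exact_mod_cast hN
  rw [expectation, expectation, formalIntegral_twoVertex B s a, mul_assoc,
    MvPowerSeries.coeff_C_mul, zpow_neg, zpow_natCast, inv_mul_cancel_left₀ (pow_ne_zero _ hN')]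

theorem isLargeNCovariance [DecidableEq R] (hd : 0 < d) {B : R → ColoredGraph d} {ω : R → ℕ}
    {ρ : ∀ r, (B r).White ≃ (B r).Black} (hT : ∀ r, (B r).Tight (ω r) (ρ r))
    {C : MvPowerSeries R ℂ}
    (hC : C = MvPowerSeries.melonicMap (fun r => (Fintype.card (B r).White : ℂ))
      (fun r => Fintype.card (B r).White) C) :
    IsLargeNCovariance B (fun r => d - ω r) C := by
  intro m
  have h1 := deviation_isBigO hd hT hC m (twoVertex d) d fun π => by rw [totalCycles_twoVertex]
  have hcount : (twoVertex d).countPairings d = 1 := by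
    unfold countPairings
    simp only [totalCycles_twoVertex]
    simp [Fintype.card_equiv ((twoVertex d).edge ⟨0, hd⟩)]
  -- Setting the value at `N = 0` to zero allows the asymptotic bound to be turned into one valid
  -- for all `N`, since the inverse of `0` is `0`.
  have h2 : (fun N : ℕ => if N = 0 then 0 else
      deviation B (fun r => d - ω r) C m (twoVertex d) d N) =O[atTop]
      fun N : ℕ => ((N : ℝ))⁻¹ := by
    refine h1.congr' ?_ EventuallyEq.rfl
    filter_upwards [eventually_ge_atTop 1] with N hN
    rw [if_neg (Nat.one_le_iff_ne_zero.1 hN)]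
  obtain ⟨K, hK⟩ := (isBigO_nat_atTop_iff fun N hN => by
    rw [inv_eq_zero, Nat.cast_eq_zero] at hN
    rw [if_pos hN]).1 h2
  -- The off-diagonal terms vanish, so they only require a nonnegative constant.
  refine ⟨max K 0, fun N a a' => ?_⟩
  have hN : N ≠ 0 := by
    rintro rfl
    exact (a ⟨0, hd⟩).elim0
  by_cases h : a = a'
  · subst h
    have := hK N
    rw [if_neg hN, deviation, hcount, norm_inv, Real.norm_natCast, Nat.cast_one, one_mul,
      Fintype.card_unique, pow_one] at this
    rw [if_pos rfl, coeff_expectation_covariance_self B _ hN]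
    refine this.trans ?_
    rw [div_eq_mul_inv]
    gcongr
    exact le_max_left _ _
  · rw [if_neg h, expectation_covariance_of_ne B _ h]
    simp only [map_zero, sub_zero, norm_zero]
    positivity

/-- The number of dominant graphs of a bubble. -/
theorem IsBubble.ncard_dominantGraphs (hd : 0 < d) {A : ColoredGraph d} (hA : A.IsBubble) {D : ℕ}
    (hD : ∀ π, A.totalCycles π ≤ D) (hD' : ∃ π, A.totalCycles π = D) :
    A.dominantGraphs.ncard = A.countPairings D := by
  obtain ⟨π₀, h0⟩ := hD'
  unfold countPairings
  rw [← Set.ncard_coe_finset]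
  congr 1
  ext π
  simp only [dominantGraphs, hA.mem_feynmanGraphs hd, true_and, forall_const, Set.mem_ofPred_eq,
    Finset.coe_filter, Finset.mem_univ, Nat.cast_inj]
  constructor
  · intro h
    exact le_antisymm (hD π) (h0 ▸ h π₀)
  · rintro h π'
    rw [h]
    exact hD π'

end Model

theorem card_white_eq_numVertices_div_two (hd : 0 < d) (A : ColoredGraph d) :
    A.numVertices / 2 = Fintype.card A.White := by
  unfold numVertices
  rw [← card_white_eq_card_black hd]
  omega

end ColoredGraph

/-! ### Assembly of the three statements. -/

theorem theorem3 {d : ℕ} (hd : 2 < d) {R : Type} [Fintype R] [DecidableEq R]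
    (B : R → ColoredGraph d) (S : R → Multiset (Finset (Fin d)))
    (hB : ∀ r, (B r).IsTotallyUnbalancedGM (S r)) :
    ColoredGraph.GaussianAtLargeN B ∧
    ∃ C : MvPowerSeries R ℂ,
      ColoredGraph.IsLargeNCovariance B (fun r => (B r).scaling (S r)) C ∧
      C = 1 - ∑ r, MvPowerSeries.C ((1 / 2 : ℂ) * ((B r).numVertices : ℂ)) * MvPowerSeries.X r *
            C ^ ((B r).numVertices / 2) ∧
      ∀ A : ColoredGraph d, A.IsBubble → ∃ Ω : ℤ, ∀ m : R →₀ ℕ,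
        (fun N : ℕ =>
            (N : ℂ) ^ (-Ω) * MvPowerSeries.coeff m
              (ColoredGraph.expectation B (fun r => (B r).scaling (S r)) N fun T => A.poly T) -
            MvPowerSeries.coeff m
              (MvPowerSeries.C (A.dominantGraphs.ncard : ℂ) * C ^ (A.numVertices / 2)))
          =O[atTop] fun N : ℕ => ((N : ℝ))⁻¹ := by
  have hd' : 0 < d := by omega
  choose ω ρ hT hs hcard using fun r => (hB r).exists_tight hd'
  refine ⟨ColoredGraph.gaussianAtLargeN hd' hT fun r => Fintype.card_pos_iff.1 (hcard r), ?_⟩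
  obtain ⟨C, hC⟩ := MvPowerSeries.exists_melonicMap_eq
    (fun r => (Fintype.card (B r).White : ℂ)) fun r => Fintype.card (B r).White
  simp only [hs, ColoredGraph.card_white_eq_numVertices_div_two hd']
  refine ⟨C, ColoredGraph.isLargeNCovariance hd' hT hC, ?_, fun A hA => ?_⟩
  · have hV : ∀ r, (1 / 2 : ℂ) * ((B r).numVertices : ℂ) = Fintype.card (B r).White := fun r => by
      rw [ColoredGraph.numVertices, ← ColoredGraph.card_white_eq_card_black hd']
      push_cast
      ring
    simp only [hV]
    exact hC
  · have hne : Nonempty (A.White ≃ A.Black) := ⟨A.edge ⟨0, hd'⟩⟩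
    obtain ⟨π₀, hπ₀⟩ := Finite.exists_max A.totalCycles
    -- `Ω` is the maximal number of cycles over all pairings, all of which are Feynman graphs
    -- because `A` is connected.
    refine ⟨A.totalCycles π₀, fun m => ?_⟩
    rw [hA.ncard_dominantGraphs hd' hπ₀ ⟨π₀, rfl⟩]
    simp only [MvPowerSeries.coeff_C_mul]
    exact ColoredGraph.deviation_isBigO hd' hT hC m A _ fun π => by exact_mod_cast hπ₀ π
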